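/- Let $k$ be a field and let $G$ be a finite simple graph with vertex set $V$. For a simplicial complex $\Delta$ on $n$ vertices (every vertex is a face) whose largest faces have $d$ vertices, let $c = n - d$ be its codimension, let $S = k[x_1,\dots,x_n]$ be the standard graded polynomial ring with one variable for each vertex, and let $I_\Delta \subseteq S$ be the Stanley-Reisner ideal, generated by the monomials $\prod_{v\in F} x_v$ of the nonfaces $F$ of $\Delta$ (the empty set counts as a face). The modified type of $\Delta$ is $$\operatorname{type}(\Delta) = \dim_k \operatorname{Tor}^S_c(S/I_\Delta,k) - \dim_k \operatorname{Tor}^S_c(S/I_\Delta,k)_c ,$$ where $M_c$ denotes the degree $c$ component of a graded module $M$, and the type defect of $\Delta$ is $\operatorname{td}(\Delta) = \operatorname{type}(\Delta) - c$. For a subset $W \subseteq V$ let $G|_W$ be the induced subgraph of $G$ on $W$, viewed as the simplicial complex with vertex set $W$ whose nonempty faces are the vertices and edges of $G|_W$. Theorem. The graph $G$ is chordal (that is, it has no induced cycle of length at least $4$) if and only if $\operatorname{td}(G|_W) \ge 0$ for every subset $W \subseteq V$. -/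

import Mathlib

open CategoryTheory MonoidalCategory MvPolynomial
open scoped TensorProduct

noncomputable section

namespace TypeDefect

universe u v

section Tor

variable {k : Type u} [Field k] {V : Type v}

/-- The degree `j` component of `S ⧸ J`, where `S = k[x_v : v ∈ V]` has the standard grading:
the classes of the homogeneous polynomials of degree `j`. -/
def quotientDegree (J : Ideal (MvPolynomial V k)) (j : ℕ) : AddSubgroup (MvPolynomial V k ⧸ J) :=
  (homogeneousSubmodule V k j).toAddSubgroup.map (Ideal.Quotient.mk J).toAddMonoidHom

/-- A projective resolution of the `S`-module `N` (with `S = k[x_v : v ∈ V]`, and `N` graded by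
`gN`) by graded `S`-modules, whose differentials and augmentation preserve degrees. -/
structure GradedResolution (N : ModuleCat.{max u v} (MvPolynomial V k))
    (gN : ℕ → AddSubgroup N) where
  /-- the underlying projective resolution -/
  res : ProjectiveResolution N
  /-- the degree `j` component of the `i`-th module of the resolution -/
  gr : ∀ i : ℕ, ℕ → AddSubgroup (res.complex.X i)
  /-- each module of the resolution is the direct sum of its graded components -/
  isInternal : ∀ i, DirectSum.IsInternal (gr i)
  smul_mem : ∀ (i a b : ℕ) (f : MvPolynomial V k) (x : res.complex.X i),
    f.IsHomogeneous a → x ∈ gr i b → f • x ∈ gr i (a + b)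
  d_mem : ∀ (i j : ℕ) (x : res.complex.X (i + 1)),
    x ∈ gr (i + 1) j → (res.complex.d (i + 1) i).hom x ∈ gr i j
  π_mem : ∀ (j : ℕ) (x : res.complex.X 0), x ∈ gr 0 j → (res.π.f 0).hom x ∈ gN j

/-- The degree `j` component of the tensor product of two graded `S`-modules: it is generated by
the tensors `m ⊗ x` of homogeneous elements with `deg m + deg x = j`. -/
def tensorDegree {M N : Type*} [AddCommGroup M] [Module (MvPolynomial V k) M]
    [AddCommGroup N] [Module (MvPolynomial V k) N]
    (gM : ℕ → AddSubgroup M) (gN : ℕ → AddSubgroup N) (j : ℕ) :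
    AddSubgroup (M ⊗[MvPolynomial V k] N) :=
  AddSubgroup.closure {t | ∃ a b, a + b = j ∧ ∃ m ∈ gM a, ∃ x ∈ gN b, m ⊗ₜ x = t}

/-- `Tor_i^S(M, N)`, as a vector space over `k`. -/
abbrev torSpace (M N : ModuleCat.{max u v} (MvPolynomial V k)) (i : ℕ) : ModuleCat k :=
  (ModuleCat.restrictScalars (C : k →+* MvPolynomial V k)).obj
    (((Tor (ModuleCat.{max u v} (MvPolynomial V k)) i).obj M).obj N)

/-- The degree `j` component `Tor_i^S(M, N)_j` for graded modules `M` and `N`: the classes of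
`Tor_i^S(M, N) = H_i(M ⊗ P)` represented by a cycle which is homogeneous of degree `j`, where `P`
is a graded projective resolution of `N`. (The component does not depend on `P`.) -/
def torDegree (M N : ModuleCat.{max u v} (MvPolynomial V k))
    (gM : ℕ → AddSubgroup M) (gN : ℕ → AddSubgroup N) (i j : ℕ) :
    Submodule k (torSpace M N i) :=
  Submodule.span k {t : torSpace M N i | ∃ P : GradedResolution N gN,
    ∃ z : ((((tensoringLeft _).obj M).mapHomologicalComplex _).obj P.res.complex).cycles i,
      ((((((tensoringLeft _).obj M).mapHomologicalComplex _).obj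
        P.res.complex).iCycles i).hom z : M ⊗[MvPolynomial V k] P.res.complex.X i)
          ∈ tensorDegree gM (P.gr i) j ∧
      (P.res.isoLeftDerivedObj ((tensoringLeft _).obj M) i).inv.hom
        (((((tensoringLeft _).obj M).mapHomologicalComplex _).obj
          P.res.complex).homologyπ i |>.hom z) = t}

end Tor

section Complex

/-- The residue field `k = S ⧸ (x_v : v ∈ V)` is the quotient by the ideal of all variables. -/
def irrelevantIdeal (k : Type u) [Field k] (V : Type v) : Ideal (MvPolynomial V k) :=
  Ideal.span (Set.range X)

variable {V : Type v} (k : Type u) [Field k] (Δ : AbstractSimplicialComplex V)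

/-- The Stanley-Reisner ideal: it is generated by the squarefree monomials of the nonfaces. (The
empty set counts as a face of every complex, although it is not listed in `Δ.faces`.) -/
def stanleyReisnerIdeal : Ideal (MvPolynomial V k) :=
  Ideal.span {f | ∃ F : Finset V, F.Nonempty ∧ F ∉ Δ ∧ f = ∏ x ∈ F, X x}

/-- The total Betti number `b_i(S/I_Δ) = dim_k Tor_i^S(S/I_Δ, k)`. -/
def betti (i : ℕ) : ℕ :=
  Module.finrank k (torSpace
    (ModuleCat.of (MvPolynomial V k) (MvPolynomial V k ⧸ stanleyReisnerIdeal k Δ))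
    (ModuleCat.of (MvPolynomial V k) (MvPolynomial V k ⧸ irrelevantIdeal k V)) i)

/-- The graded Betti number `b_{i,j}(S/I_Δ) = dim_k Tor_i^S(S/I_Δ, k)_j`. -/
def gradedBetti (i j : ℕ) : ℕ :=
  Module.finrank k (torDegree
    (ModuleCat.of (MvPolynomial V k) (MvPolynomial V k ⧸ stanleyReisnerIdeal k Δ))
    (ModuleCat.of (MvPolynomial V k) (MvPolynomial V k ⧸ irrelevantIdeal k V))
    (quotientDegree (stanleyReisnerIdeal k Δ)) (quotientDegree (irrelevantIdeal k V)) i j)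

open Classical in
/-- The codimension `n - d`, where `n` is the number of vertices and `d` is the largest number of
vertices of a face. -/
def codim [Fintype V] : ℕ :=
  Fintype.card V - (Finset.univ.filter (fun F : Finset V => F ∈ Δ)).sup Finset.card

/-- The modified type `dim_k Tor_c^S(S/I_Δ, k) - dim_k Tor_c^S(S/I_Δ, k)_c`, where `c` is the
codimension. -/
def modifiedType [Fintype V] : ℤ :=
  (betti k Δ (codim Δ) : ℤ) - gradedBetti k Δ (codim Δ) (codim Δ)

/-- The type defect: the modified type minus the codimension. -/
def typeDefect [Fintype V] : ℤ :=
  modifiedType k Δ - codim Δ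

end Complex

section Graph

variable {V : Type v} (G : SimpleGraph V)

/-- A simple graph as a simplicial complex: the nonempty faces are the vertices and the edges. -/
def graphComplex : AbstractSimplicialComplex V where
  faces := {F | F.Nonempty ∧ F.card ≤ 2 ∧ G.IsClique (F : Set V)}
  isRelLowerSet_faces := fun _ hF => ⟨hF.1, fun _ hEF hE =>
    ⟨hE, (Finset.card_le_card hEF).trans hF.2.1, hF.2.2.subset (Finset.coe_subset.2 hEF)⟩⟩
  singleton_mem v := by simp

/-- A graph is chordal if it has no induced cycle of length at least four. -/
def IsChordal : Prop :=
  ∀ m : ℕ, 4 ≤ m → IsEmpty (SimpleGraph.cycleGraph m ↪g G)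

end Graph

end TypeDefect

end

noncomputable section

set_option linter.unusedSectionVars false

/-! Hochster's formula writes the dimension of `Tor_i(S/I, k)` as the sum over `W ⊆ V` of the
dimensions of the reduced cohomology of the induced complex on `W` in degree `|W| - i - 1`. For a
graph and `i > 0` only two sizes of `W` contribute: `|W| = i + 1` gives `comp(W) - 1`, and `|W| = i
+ 2` gives the cycle rank `e(W) - |W| + comp(W)`.

Let `n = |V|`. If there is an edge and `c = n - 2 > 0`, only `V` and the sets `V - v` contribute to
`Tor_c`. The part of `Tor_c` in degree `c` vanishes because `I` contains no linear form
(`torDegree_self_eq_bot`). Hence the type defect is nonnegative exactly when `3n ≤ ∑ v, comp(V - v)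
+ e(V) + comp(V) + 2`. An edgeless graph with `c = n - 1 > 0` has type `n - 1` and defect zero, and
for `c = 0` there is nothing to prove beyond the graded part being a subspace.

For chordal graphs the inequality follows by induction: Dirac's theorem (`exists_isSimplicialIn`)
gives a simplicial vertex, and deleting it lowers the right side by at least three
(`three_mul_card_le_step`). Chordality passes to induced subgraphs, so every `W` is covered.
Conversely, on an induced cycle of length `n ≥ 4` all the component counts are at most one and there
are at most `n` edges, so the type is at most `1 < n - 2`.

The algebraic half proves Hochster's formula from the Koszul resolution of `k` (`koszulResolution`).
The Koszul complex of `S/I` splits by multidegree. Strands in multidegrees that are not squarefree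
are cones, hence acyclic, and the strand of a squarefree multidegree `W` has basis the `x^(W \ F)
e_F` with `W \ F` a face; its differential is the coboundary
(`exists_koszulCycles_to_strandHomology`, `betti_eq_sum`). As the graded pieces of `Tor` are defined
through arbitrary graded resolutions, a degree-preserving comparison with the Koszul resolution is
needed as well (`exists_graded_comparison`). -/

namespace TypeDefect

universe u v w

/-! ### The Koszul differential and its contracting homotopy -/

section Koszul

variable {V : Type v} [LinearOrder V] [Fintype V]

/-- The sign with which the variable of `v` enters the Koszul differential at `F`. -/
def koszulSign (v : V) (F : Finset V) : ℤ := (-1) ^ (F.filter (· < v)).card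

lemma koszulSign_mul_self (v : V) (F : Finset V) : koszulSign v F * koszulSign v F = 1 := by
  rw [koszulSign, ← mul_pow]; simp

lemma koszulSign_insert_of_lt {u v : V} {F : Finset V} (hv : v ∉ F) (h : v < u) :
    koszulSign u (insert v F) = -koszulSign u F := by
  rw [koszulSign, Finset.filter_insert, if_pos h, Finset.card_insert_of_notMem (by simp [hv]),
    pow_succ, koszulSign]
  ring

lemma koszulSign_insert_of_not_lt {u v : V} {F : Finset V} (h : ¬ v < u) :
    koszulSign u (insert v F) = koszulSign u F := by
  rw [koszulSign, Finset.filter_insert, if_neg h, koszulSign]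

/-- Adding the smaller of the two elements first raises by one the number of elements below the
larger; adding the larger first does not affect the smaller. -/
lemma koszulSign_anticomm {u v : V} {F : Finset V} (hu : u ∉ F) (hv : v ∉ F) (huv : u ≠ v) :
    koszulSign v F * koszulSign u (insert v F) = -(koszulSign u F * koszulSign v (insert u F)) := by
  rcases lt_or_gt_of_ne huv with h | h
  · rw [koszulSign_insert_of_not_lt h.not_gt, koszulSign_insert_of_lt hu h]; ring
  · rw [koszulSign_insert_of_not_lt h.not_gt, koszulSign_insert_of_lt hv h]; ring

/-- The Koszul differential on all exterior degrees at once, for a family `x` of commuting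
endomorphisms. -/
def contraction {R M : Type*} [CommRing R] [AddCommGroup M] [Module R M] (x : V → R) :
    (Finset V → M) →ₗ[R] (Finset V → M) where
  toFun g F := ∑ v ∈ Fᶜ, koszulSign v F • x v • g (insert v F)
  map_add' g h := by
    ext F
    simp [Finset.sum_add_distrib]
  map_smul' c g := by
    ext F
    simp only [Pi.smul_apply, RingHom.id_apply, Finset.smul_sum]
    refine Finset.sum_congr rfl fun v _ => ?_
    rw [smul_comm c (koszulSign v F), smul_comm c (x v)]

lemma contraction_apply {R M : Type*} [CommRing R] [AddCommGroup M] [Module R M] (x : V → R)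
    (g : Finset V → M) (F : Finset V) :
    contraction x g F = ∑ v ∈ Fᶜ, koszulSign v F • x v • g (insert v F) := rfl

/-- The terms that add `v` then `u` and `u` then `v` cancel, by `koszulSign_anticomm`. -/
lemma contraction_contraction {R M : Type*} [CommRing R] [AddCommGroup M] [Module R M]
    (x : V → R) (g : Finset V → M) : contraction x (contraction x g) = 0 := by
  ext F
  simp only [contraction_apply, Finset.smul_sum, Pi.zero_apply]
  rw [Finset.sum_sigma']
  refine Finset.sum_involution (fun p _ => ⟨p.2, p.1⟩) ?_ ?_ ?_ ?_
  · rintro ⟨v, u⟩ h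
    simp only [Finset.mem_sigma, Finset.mem_compl, Finset.mem_insert, not_or] at h
    obtain ⟨hv, huv, hu⟩ := h
    simp only
    rw [smul_comm (x v) (koszulSign u _), smul_comm (x u) (koszulSign v _), smul_smul, smul_smul,
      koszulSign_anticomm hu hv huv, Finset.insert_comm, smul_comm (x u) (x v), neg_smul]
    simp only [smul_smul, neg_add_cancel]
  · rintro ⟨v, u⟩ h _ heq
    simp only [Finset.mem_sigma, Finset.mem_compl, Finset.mem_insert, not_or] at h
    simp only [Sigma.mk.injEq, heq_eq_eq] at heq
    exact h.2.1 heq.1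
  · rintro ⟨v, u⟩ h
    simp only [Finset.mem_sigma, Finset.mem_compl, Finset.mem_insert, not_or] at h ⊢
    exact ⟨h.2.2, fun e => h.2.1 e.symm, h.1⟩
  · rintro ⟨v, u⟩ _
    rfl

/-- The functions on finite sets that are concentrated on the sets with `i` elements. -/
def Concentrated {M : Type*} [Zero M] (i : ℕ) (g : Finset V → M) : Prop :=
  ∀ F, F.card ≠ i → g F = 0

lemma Concentrated.contraction {R M : Type*} [CommRing R] [AddCommGroup M] [Module R M]
    (x : V → R) {i : ℕ} {g : Finset V → M} (hg : Concentrated (i + 1) g) :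
    Concentrated i (contraction x g) := by
  intro F hF
  rw [contraction_apply]
  refine Finset.sum_eq_zero fun v hv => ?_
  rw [hg, smul_zero, smul_zero]
  rw [Finset.card_insert_of_notMem (by simpa using hv)]
  omega

lemma contraction_eq_zero_of_concentrated_zero {R M : Type*} [CommRing R] [AddCommGroup M]
    [Module R M] (x : V → R) {g : Finset V → M} (hg : Concentrated 0 g) :
    TypeDefect.contraction x g = 0 := by
  ext F
  rw [contraction_apply]
  refine Finset.sum_eq_zero fun v hv => ?_
  rw [hg, smul_zero, smul_zero]
  rw [Finset.card_insert_of_notMem (by simpa using hv)]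
  omega

/-- A homotopy for the Koszul differential of the family `1`. -/
def expansion {k : Type u} [Field k] (v : V) (φ : Finset V → k) (F : Finset V) : k :=
  if v ∈ F then koszulSign v (F.erase v) • φ (F.erase v) else 0

/-- Exterior multiplication by `e_v` and contraction with `∑ e_u^*` have anticommutator `e_v^*(e_v)
= 1`. -/
lemma contraction_expansion_add {k : Type u} [Field k] (v : V) (φ : Finset V → k) :
    contraction (1 : V → k) (expansion v φ) + expansion v (contraction (1 : V → k) φ) = φ := by
  ext F
  simp only [Pi.add_apply, contraction_apply, Pi.one_apply, one_smul]
  by_cases hv : v ∈ F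
  · obtain ⟨E, hE, rfl⟩ : ∃ E, v ∉ E ∧ insert v E = F :=
      ⟨F.erase v, by simp, Finset.insert_erase hv⟩
    have h1 : (Eᶜ : Finset V) = insert v (insert v E)ᶜ := by
      ext u; by_cases h : u = v <;> simp [h, hE]
    simp only [expansion, Finset.mem_insert_self, if_true, Finset.erase_insert hE,
      contraction_apply, Pi.one_apply, one_smul]
    -- In the second summand the index `v` already returns `φ (insert v E)`; the remaining indices
    -- cancel against the first summand one by one.
    rw [h1, Finset.sum_insert (by simp), smul_add, smul_smul, koszulSign_mul_self, one_smul,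
      add_left_comm, add_eq_left, Finset.smul_sum, ← Finset.sum_add_distrib]
    refine Finset.sum_eq_zero fun u hu => ?_
    simp only [Finset.mem_compl, Finset.mem_insert, not_or] at hu
    have h2 : (insert u (insert v E)).erase v = insert u E := by
      rw [Finset.insert_comm, Finset.erase_insert]
      simp [hE, Ne.symm hu.1]
    rw [if_pos (by simp), h2, smul_smul, smul_smul, ← add_smul]
    have h3 := koszulSign_anticomm hu.2 hE hu.1
    have h4 := koszulSign_mul_self u E
    have h5 := koszulSign_mul_self v E
    have : koszulSign u (insert v E) * koszulSign v (insert u E) =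
        -(koszulSign v E * koszulSign u E) := by
      calc _ = (koszulSign v E * koszulSign v E) *
            (koszulSign u (insert v E) * koszulSign v (insert u E)) := by rw [h5, one_mul]
        _ = koszulSign v E * (koszulSign v E * koszulSign u (insert v E)) *
            koszulSign v (insert u E) := by ring
        _ = -(koszulSign v E * koszulSign u E) *
            (koszulSign v (insert u E) * koszulSign v (insert u E)) := by rw [h3]; ring
        _ = _ := by rw [koszulSign_mul_self, mul_one]
    rw [this, neg_add_cancel, zero_smul]
  · have h1 : expansion v (contraction (1 : V → k) φ) F = 0 := if_neg hv
    rw [h1, add_zero, Finset.sum_eq_single_of_mem v (by simpa using hv)]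
    · rw [expansion, if_pos (by simp), Finset.erase_insert hv, smul_smul, koszulSign_mul_self,
        one_smul]
    · intro u _ huv
      rw [expansion, if_neg (by simp [hv, Ne.symm huv]), smul_zero]

/-- If `v` can be removed from and added to the members of `D`, then the strand of the Koszul
complex supported on `D` is acyclic. -/
lemma exists_contraction_eq_of_cone {k : Type u} [Field k] {D : Finset V → Prop} (v : V)
    (herase : ∀ F, D F → v ∈ F → D (F.erase v)) (hinsert : ∀ F, D (F.erase v) → v ∈ F → D F)
    {i : ℕ} {φ : Finset V → k} (hφD : ∀ F, ¬ D F → φ F = 0) (hφ : Concentrated i φ)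
    (hcycle : ∀ F, D F → contraction (1 : V → k) φ F = 0) :
    ∃ ψ : Finset V → k, (∀ F, ¬ D F → ψ F = 0) ∧ Concentrated (i + 1) ψ ∧
      ∀ F, D F → φ F = contraction (1 : V → k) ψ F := by
  refine ⟨expansion v φ, fun F hF => ?_, fun F hF => ?_, fun F hF => ?_⟩
  · rw [expansion]
    split_ifs with hv
    · rw [hφD, smul_zero]
      exact fun h => hF (hinsert F h hv)
    · rfl
  · rw [expansion]
    split_ifs with hv
    · rw [hφ, smul_zero]
      rw [Finset.card_erase_of_mem hv]
      have := Finset.card_pos.2 ⟨v, hv⟩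
      omega
    · rfl
  · have h := congrFun (contraction_expansion_add v φ) F
    rw [Pi.add_apply] at h
    rw [← h, add_eq_left, expansion]
    split_ifs with hv
    · rw [hcycle _ (herase F hF hv), smul_zero]
    · rfl

end Koszul

/-! ### Multigraded components and exactness of the Koszul complex -/

section Strands

variable {k : Type u} [Field k] {V : Type v} [LinearOrder V] [Fintype V]

/-- The exponent of the squarefree monomial of `F`. -/
def indicatorExp (F : Finset V) : V →₀ ℕ := ∑ v ∈ F, Finsupp.single v 1

lemma indicatorExp_apply (F : Finset V) (v : V) : indicatorExp F v = if v ∈ F then 1 else 0 := by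
  simp [indicatorExp, Finsupp.finsetSum_apply, Finsupp.single_apply]

lemma indicatorExp_insert {v : V} {F : Finset V} (hv : v ∉ F) :
    indicatorExp (insert v F) = indicatorExp F + Finsupp.single v 1 := by
  rw [indicatorExp, Finset.sum_insert hv, add_comm, indicatorExp]

/-- The sets which occur in multidegree `a` of the Koszul complex of the quotient by the ideal of
the monomials whose exponents are not in `B`. -/
def strand (B : Set (V →₀ ℕ)) (a : V →₀ ℕ) (F : Finset V) : Prop :=
  indicatorExp F ≤ a ∧ a - indicatorExp F ∈ B

open Classical in
/-- The component in multidegree `a` of an element of the Koszul complex. -/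
def component (B : Set (V →₀ ℕ)) (a : V →₀ ℕ) (g : Finset V → MvPolynomial V k)
    (F : Finset V) : k :=
  if strand B a F then coeff (a - indicatorExp F) (g F) else 0

lemma component_of_not_strand {B : Set (V →₀ ℕ)} {a : V →₀ ℕ} {F : Finset V}
    (h : ¬ strand B a F) (g : Finset V → MvPolynomial V k) : component B a g F = 0 := if_neg h

lemma component_of_strand {B : Set (V →₀ ℕ)} {a : V →₀ ℕ} {F : Finset V}
    (h : strand B a F) (g : Finset V → MvPolynomial V k) :
    component B a g F = coeff (a - indicatorExp F) (g F) := if_pos h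

lemma Concentrated.component {B : Set (V →₀ ℕ)} (a : V →₀ ℕ) {i : ℕ}
    {g : Finset V → MvPolynomial V k} (hg : Concentrated i g) :
    Concentrated i (component B a g) := by
  intro F hF
  rw [TypeDefect.component, hg F hF]
  simp

lemma component_add {B : Set (V →₀ ℕ)} (a : V →₀ ℕ) (g h : Finset V → MvPolynomial V k) :
    component B a (g + h) = component B a g + component B a h := by
  ext F
  simp only [component, Pi.add_apply, coeff_add]
  split_ifs <;> simp

lemma component_smul {B : Set (V →₀ ℕ)} (a : V →₀ ℕ) (c : k) (g : Finset V → MvPolynomial V k) :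
    component B a (c • g) = c • component B a g := by
  ext F
  simp only [component, Pi.smul_apply, coeff_smul]
  split_ifs <;> simp

lemma strand_insert_iff {B : Set (V →₀ ℕ)} (hB : IsLowerSet B) {a : V →₀ ℕ} {F : Finset V}
    (hF : strand B a F) {v : V} (hv : v ∉ F) :
    strand B a (insert v F) ↔ v ∈ (a - indicatorExp F).support := by
  rw [Finsupp.mem_support_iff, strand, indicatorExp_insert hv]
  constructor
  · rintro ⟨h, -⟩
    have := h v
    simp only [Finsupp.add_apply, Finsupp.single_eq_same, Finsupp.tsub_apply] at this ⊢
    omega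
  · intro h
    refine ⟨fun u => ?_, hB (fun u => ?_) hF.2⟩
    · have := hF.1 u
      by_cases hu : u = v
      · subst hu
        simp only [Finsupp.add_apply, Finsupp.single_eq_same, Finsupp.tsub_apply] at h ⊢
        omega
      · simpa [Finsupp.single_apply, Ne.symm hu] using this
    · simp only [Finsupp.add_apply, Finsupp.tsub_apply]
      omega

/-- The coefficient of `x_v g` at an exponent is the coefficient of `g` at that exponent lowered by
one at `v`. Within one multidegree every variable therefore acts as `1`, which leaves a complex of
vector spaces. -/
lemma component_contraction {B : Set (V →₀ ℕ)} (hB : IsLowerSet B) {a : V →₀ ℕ} {F : Finset V}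
    (hF : strand B a F) (g : Finset V → MvPolynomial V k) :
    component B a (contraction (X : V → MvPolynomial V k) g) F =
      contraction (1 : V → k) (component B a g) F := by
  classical
  rw [component_of_strand hF, contraction_apply, contraction_apply, coeff_sum]
  refine Finset.sum_congr rfl fun v hv => ?_
  have hv : v ∉ F := by simpa using hv
  rw [Pi.one_apply, one_smul, smul_eq_mul, zsmul_eq_mul, zsmul_eq_mul,
    ← map_intCast (C : k →+* MvPolynomial V k), coeff_C_mul, mul_comm (X v), coeff_mul_X']
  congr 1
  split_ifs with h
  · rw [component_of_strand ((strand_insert_iff hB hF hv).2 h), indicatorExp_insert hv,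
      tsub_add_eq_tsub_tsub]
  · rw [component_of_not_strand (mt (strand_insert_iff hB hF hv).1 h)]

open Classical in
/-- The element of the Koszul complex with prescribed component in multidegree `a`, and with no
other components. -/
def ofComponent (a : V →₀ ℕ) (φ : Finset V → k) (F : Finset V) : MvPolynomial V k :=
  if indicatorExp F ≤ a then monomial (a - indicatorExp F) (φ F) else 0

lemma Concentrated.ofComponent (a : V →₀ ℕ) {i : ℕ} {φ : Finset V → k} (hφ : Concentrated i φ) :
    Concentrated i (ofComponent a φ) := by
  intro F hF
  rw [TypeDefect.ofComponent, hφ F hF]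
  simp

lemma component_ofComponent_self {B : Set (V →₀ ℕ)} (a : V →₀ ℕ) {φ : Finset V → k}
    (hφ : ∀ F, ¬ strand B a F → φ F = 0) : component B a (ofComponent a φ) = φ := by
  ext F
  by_cases hF : strand B a F
  · rw [component_of_strand hF, ofComponent, if_pos hF.1, coeff_monomial, if_pos rfl]
  · rw [component_of_not_strand hF, hφ F hF]

lemma component_ofComponent_of_ne {B : Set (V →₀ ℕ)} {a b : V →₀ ℕ} (hab : a ≠ b)
    (φ : Finset V → k) : component B b (ofComponent a φ) = 0 := by
  classical
  ext F
  by_cases hF : strand B b F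
  · rw [component_of_strand hF, ofComponent]
    split_ifs with h
    · rw [coeff_monomial, if_neg, Pi.zero_apply]
      intro e
      exact hab (by rw [← tsub_add_cancel_of_le h, e, tsub_add_cancel_of_le hF.1])
    · simp
  · rw [component_of_not_strand hF, Pi.zero_apply]

lemma mem_of_component_eq_zero {B : Set (V →₀ ℕ)} {J : Ideal (MvPolynomial V k)}
    (hJ : ∀ p, p ∈ J ↔ ∀ m ∈ B, coeff m p = 0) {g : Finset V → MvPolynomial V k}
    (hg : ∀ a, component B a g = 0) (F : Finset V) : g F ∈ J := by
  rw [hJ]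
  intro m hm
  have h := congrFun (hg (m + indicatorExp F)) F
  rwa [component_of_strand ⟨le_add_self, by rwa [add_tsub_cancel_right]⟩,
    add_tsub_cancel_right] at h

lemma component_eq_zero_of_mem {B : Set (V →₀ ℕ)} {J : Ideal (MvPolynomial V k)}
    (hJ : ∀ p, p ∈ J ↔ ∀ m ∈ B, coeff m p = 0) {g : Finset V → MvPolynomial V k}
    (hg : ∀ F, g F ∈ J) (a : V →₀ ℕ) : component B a g = 0 := by
  ext F
  by_cases hF : strand B a F
  · rw [component_of_strand hF, (hJ _).1 (hg F) _ hF.2, Pi.zero_apply]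
  · rw [component_of_not_strand hF, Pi.zero_apply]

/-- An element of the Koszul complex is a boundary modulo `J` if all its components are. -/
lemma exists_contraction_of_component {B : Set (V →₀ ℕ)} (hB : IsLowerSet B)
    {J : Ideal (MvPolynomial V k)} (hJ : ∀ p, p ∈ J ↔ ∀ m ∈ B, coeff m p = 0) {i : ℕ}
    {g : Finset V → MvPolynomial V k}
    (hg : ∀ a, ∃ ψ : Finset V → k, (∀ F, ¬ strand B a F → ψ F = 0) ∧ Concentrated (i + 1) ψ ∧
      ∀ F, strand B a F → component B a g F = contraction (1 : V → k) ψ F) :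
    ∃ ψ : Finset V → MvPolynomial V k, Concentrated (i + 1) ψ ∧
      ∀ F, g F - contraction (X : V → MvPolynomial V k) ψ F ∈ J := by
  classical
  choose ψ hψD hψ hψg using hg
  -- Every multidegree with a nonzero component lies in this finite set, so the solutions of the
  -- separate multidegrees can be added up.
  let T : Finset (V →₀ ℕ) := Finset.univ.biUnion fun F : Finset V =>
    (g F).support.image (· + indicatorExp F)
  have hT : ∀ a ∉ T, component B a g = 0 := by
    intro a ha
    ext F
    by_cases hF : strand B a F
    · rw [component_of_strand hF, Pi.zero_apply]
      by_contra h
      refine ha (Finset.mem_biUnion.2 ⟨F, Finset.mem_univ _, Finset.mem_image.2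
        ⟨_, mem_support_iff.2 h, tsub_add_cancel_of_le hF.1⟩⟩)
    · rw [component_of_not_strand hF, Pi.zero_apply]
  refine ⟨∑ a ∈ T, ofComponent a (ψ a), fun F hF => ?_, ?_⟩
  · rw [Finset.sum_apply]
    exact Finset.sum_eq_zero fun a _ => (hψ a).ofComponent a F hF
  · let L (b : V →₀ ℕ) : (Finset V → MvPolynomial V k) →+ (Finset V → k) :=
      AddMonoidHom.mk' (component B b) (component_add b)
    intro F
    refine mem_of_component_eq_zero hJ
      (g := g - contraction (X : V → MvPolynomial V k) (∑ a ∈ T, ofComponent a (ψ a)))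
      (fun b => ?_) F
    change L b _ = 0
    rw [map_sub, sub_eq_zero]
    ext F
    change component B b g F = component B b _ F
    by_cases hF : strand B b F
    · rw [component_contraction hB hF]
      have h1 : component B b (∑ a ∈ T, ofComponent a (ψ a)) = if b ∈ T then ψ b else 0 := by
        change L b _ = _
        rw [map_sum]
        change ∑ a ∈ T, component B b (ofComponent a (ψ a)) = _
        rw [← Finset.sum_ite_eq' T b ψ]
        refine Finset.sum_congr rfl fun a _ => ?_
        split_ifs with h
        · subst h
          exact component_ofComponent_self a (hψD a)
        · exact component_ofComponent_of_ne h _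
      rw [h1]
      split_ifs with h
      · exact hψg b F hF
      · rw [hT b h, map_zero]
    · rw [component_of_not_strand hF, component_of_not_strand hF]

lemma strand_univ_iff (a : V →₀ ℕ) (F : Finset V) :
    strand Set.univ a F ↔ indicatorExp F ≤ a := by simp [strand]

lemma indicatorExp_mono {E F : Finset V} (h : E ⊆ F) : indicatorExp E ≤ indicatorExp F := by
  intro v
  rw [indicatorExp_apply, indicatorExp_apply]
  split_ifs with h1 h2
  · rfl
  · exact absurd (h h1) h2
  all_goals omega

lemma indicatorExp_le_of_erase {a : V →₀ ℕ} {v : V} (hv : v ∈ a.support) {F : Finset V}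
    (h : indicatorExp (F.erase v) ≤ a) : indicatorExp F ≤ a := by
  intro u
  have := h u
  rw [Finsupp.mem_support_iff] at hv
  by_cases hu : u = v
  · subst hu
    rw [indicatorExp_apply]
    split_ifs <;> omega
  · simpa [indicatorExp_apply, hu] using this

/-- The Koszul complex of the polynomial ring is exact, except in the constant part. -/
lemma exists_contraction_eq_of_coeff_zero {i : ℕ} {g : Finset V → MvPolynomial V k}
    (hg : Concentrated i g) (h0 : constantCoeff (g ∅) = 0)
    (hcycle : contraction (X : V → MvPolynomial V k) g = 0) :
    ∃ ψ : Finset V → MvPolynomial V k, Concentrated (i + 1) ψ ∧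
      contraction (X : V → MvPolynomial V k) ψ = g := by
  have hJ : ∀ p : MvPolynomial V k, p ∈ (⊥ : Ideal (MvPolynomial V k)) ↔
      ∀ m ∈ (Set.univ : Set (V →₀ ℕ)), coeff m p = 0 := by
    intro p
    simp [MvPolynomial.ext_iff]
  obtain ⟨ψ, hψ, h⟩ := exists_contraction_of_component isLowerSet_univ hJ
      (i := i) (g := g) fun a => by
    -- In multidegree zero only the empty set occurs, and its component is the constant term
    -- excluded by `h0`. In any other multidegree a vertex of the support is a cone point.
    by_cases ha : a = 0
    · refine ⟨0, by simp, fun _ _ => rfl, fun F hF => ?_⟩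
      rw [map_zero, component_of_strand hF]
      have hF0 : F = ∅ := by
        rw [strand_univ_iff, ha] at hF
        rw [Finset.eq_empty_iff_forall_notMem]
        intro v hv
        have := hF v
        rw [indicatorExp_apply, if_pos hv] at this
        simp at this
      subst hF0
      rw [ha]
      simpa [indicatorExp, constantCoeff_eq] using h0
    · obtain ⟨v, hv⟩ := Finsupp.support_nonempty_iff.2 ha
      refine exists_contraction_eq_of_cone v (fun F hF _ => ?_) (fun F hF hvF => ?_)
        (fun F hF => component_of_not_strand hF g) (hg.component a) (fun F hF => ?_)
      · rw [strand_univ_iff] at hF ⊢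
        exact (indicatorExp_mono (Finset.erase_subset v F)).trans hF
      · rw [strand_univ_iff] at hF ⊢
        exact indicatorExp_le_of_erase hv hF
      · rw [← component_contraction isLowerSet_univ hF, hcycle, component_of_strand hF]
        simp
  refine ⟨ψ, hψ, ?_⟩
  ext1 F
  exact (sub_eq_zero.1 (by simpa using h F)).symm

end Strands

/-! ### Homology through elements -/

section HomologyElements

variable {R : Type u} [Ring R]

/-- Recording homology as a surjection from cycles with known kernel allows later comparisons of
homologies to be made on elements; two such surjections with equal kernels have isomorphic targets.
-/
lemma exists_surjective_to_homology (S : ShortComplex (ModuleCat.{v} R)) :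
    ∃ p : LinearMap.ker S.g.hom →ₗ[R] S.homology, Function.Surjective p ∧
      ∀ x, p x = 0 ↔ ∃ y, S.f.hom y = x := by
  let e := S.moduleCatHomologyIso.toLinearEquiv
  refine ⟨e.symm.toLinearMap ∘ₗ (LinearMap.range S.moduleCatToCycles).mkQ,
    e.symm.surjective.comp (Submodule.mkQ_surjective _), fun x => ?_⟩
  change e.symm _ = 0 ↔ _
  rw [LinearEquiv.map_eq_zero_iff]
  refine (Submodule.Quotient.mk_eq_zero (LinearMap.range S.moduleCatToCycles)).trans ?_
  constructor
  · rintro ⟨y, hy⟩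
    exact ⟨y, congrArg Subtype.val hy⟩
  · rintro ⟨y, hy⟩
    exact ⟨y, Subtype.ext hy⟩

end HomologyElements

/-! ### The Koszul complex in separate exterior degrees -/

section KoszulComplex

variable {R : Type u} [CommRing R] {V : Type v} [LinearOrder V] [Fintype V]
  (x : V → R) (M : Type w) [AddCommGroup M] [Module R M]

/-- Extension by zero of a function on the sets with `i` elements. -/
def extendCard (R : Type u) [CommRing R] (V : Type v) [LinearOrder V] [Fintype V]
    (M : Type w) [AddCommGroup M] [Module R M] (i : ℕ) :
    ({F : Finset V // F.card = i} → M) →ₗ[R] (Finset V → M) where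
  toFun g F := if h : F.card = i then g ⟨F, h⟩ else 0
  map_add' g h := by
    ext F
    simp only [Pi.add_apply]
    split_ifs <;> simp
  map_smul' c g := by
    ext F
    simp only [Pi.smul_apply, RingHom.id_apply]
    split_ifs <;> simp

variable {M}

lemma extendCard_apply_coe {i : ℕ} (g : {F : Finset V // F.card = i} → M)
    (F : {F : Finset V // F.card = i}) : extendCard R V M i g F = g F := dif_pos F.2

lemma concentrated_extendCard {i : ℕ} (g : {F : Finset V // F.card = i} → M) :
    Concentrated i (extendCard R V M i g) := fun _ hF => dif_neg hF

lemma extendCard_restrict {i : ℕ} {g : Finset V → M} (hg : Concentrated i g) :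
    extendCard R V M i (fun F => g F) = g := by
  ext F
  by_cases h : F.card = i
  · exact dif_pos h
  · rw [hg F h]
    exact dif_neg h

lemma extendCard_injective (i : ℕ) : Function.Injective (extendCard R V M i) := by
  intro g h e
  ext F
  rw [← extendCard_apply_coe (R := R) g F, e, extendCard_apply_coe]

variable (M)

/-- The Koszul differential. -/
def koszulD (i : ℕ) :
    ({F : Finset V // F.card = i + 1} → M) →ₗ[R] ({F : Finset V // F.card = i} → M) :=
  LinearMap.funLeft R M Subtype.val ∘ₗ contraction x ∘ₗ extendCard R V M (i + 1)

variable {M}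

lemma koszulD_apply {i : ℕ} (g : {F : Finset V // F.card = i + 1} → M)
    (F : {F : Finset V // F.card = i}) :
    koszulD x M i g F = contraction x (extendCard R V M (i + 1) g) F := rfl

lemma extendCard_koszulD {i : ℕ} (g : {F : Finset V // F.card = i + 1} → M) :
    extendCard R V M i (koszulD x M i g) = contraction x (extendCard R V M (i + 1) g) :=
  extendCard_restrict ((concentrated_extendCard g).contraction x)

lemma koszulD_koszulD {i : ℕ} (g : {F : Finset V // F.card = i + 1 + 1} → M) :
    koszulD x M i (koszulD x M (i + 1) g) = 0 := by
  apply extendCard_injective (R := R)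
  rw [extendCard_koszulD, extendCard_koszulD, contraction_contraction, map_zero]

lemma koszulD_map {N : Type*} [AddCommGroup N] [Module R N] (f : M →ₗ[R] N) {i : ℕ}
    (g : {F : Finset V // F.card = i + 1} → M) (F : {F : Finset V // F.card = i}) :
    koszulD x N i (fun F => f (g F)) F = f (koszulD x M i g F) := by
  rw [koszulD_apply, koszulD_apply, contraction_apply, contraction_apply, map_sum]
  refine Finset.sum_congr rfl fun v _ => ?_
  rw [map_zsmul, map_smul]
  congr 2
  simp only [extendCard, LinearMap.coe_mk, AddHom.coe_mk]
  split_ifs <;> simp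

lemma ofHom_koszulD_comp (M : Type max u v) [AddCommGroup M] [Module R M] (i : ℕ) :
    ModuleCat.ofHom (koszulD x M (i + 1)) ≫ ModuleCat.ofHom (koszulD x M i) = 0 :=
  ModuleCat.hom_ext (LinearMap.ext fun g => koszulD_koszulD x g)

/-- The Koszul complex of a family of elements. -/
def koszulComplex (M : Type max u v) [AddCommGroup M] [Module R M] :
    ChainComplex (ModuleCat.{max u v} R) ℕ :=
  ChainComplex.of (fun i => ModuleCat.of R ({F : Finset V // F.card = i} → M))
    (fun i => ModuleCat.ofHom (koszulD x M i)) (ofHom_koszulD_comp x M)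

lemma koszulComplex_d (M : Type max u v) [AddCommGroup M] [Module R M] (i : ℕ) :
    (koszulComplex x M).d (i + 1) i = ModuleCat.ofHom (koszulD x M i) :=
  ChainComplex.of_d (fun i => ModuleCat.of R ({F : Finset V // F.card = i} → M))
    (fun i => ModuleCat.ofHom (koszulD x M i)) i

end KoszulComplex

/-! ### The Koszul resolution of the residue field -/

section Resolution

variable (k : Type u) [Field k] (V : Type v) [LinearOrder V] [Fintype V]

lemma mem_irrelevantIdeal_iff (p : MvPolynomial V k) :
    p ∈ irrelevantIdeal k V ↔ constantCoeff p = 0 := by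
  have h := mem_pow_idealOfVars_iff' 1 p
  rw [pow_one] at h
  rw [irrelevantIdeal, h]
  simp only [Nat.lt_one_iff, Finsupp.degree_eq_zero_iff, forall_eq, constantCoeff_eq]

/-- The augmentation of the Koszul complex. -/
def koszulAugmentation : ({F : Finset V // F.card = 0} → MvPolynomial V k) →ₗ[MvPolynomial V k]
    MvPolynomial V k ⧸ irrelevantIdeal k V :=
  (irrelevantIdeal k V).mkQ ∘ₗ LinearMap.proj ⟨∅, rfl⟩

lemma constantCoeff_contraction (g : Finset V → MvPolynomial V k) (F : Finset V) :
    constantCoeff (contraction (X : V → MvPolynomial V k) g F) = 0 := by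
  rw [contraction_apply, map_sum]
  exact Finset.sum_eq_zero fun v _ => by simp

lemma koszulAugmentation_koszulD (g : {F : Finset V // F.card = 0 + 1} → MvPolynomial V k) :
    koszulAugmentation k V (koszulD (X : V → MvPolynomial V k) _ 0 g) = 0 := by
  rw [koszulAugmentation, LinearMap.comp_apply, Submodule.mkQ_apply,
    Submodule.Quotient.mk_eq_zero, mem_irrelevantIdeal_iff]
  exact constantCoeff_contraction k V _ _

lemma ofHom_koszulD_comp_koszulAugmentation :
    ModuleCat.ofHom (koszulD (X : V → MvPolynomial V k) (MvPolynomial V k) 0) ≫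
      ModuleCat.ofHom (koszulAugmentation k V) = 0 :=
  ModuleCat.hom_ext (LinearMap.ext fun g => koszulAugmentation_koszulD k V g)

lemma exists_koszulD_eq_of_koszulAugmentation {g : {F : Finset V // F.card = 0} → MvPolynomial V k}
    (hg : koszulAugmentation k V g = 0) :
    ∃ ψ, koszulD (X : V → MvPolynomial V k) (MvPolynomial V k) 0 ψ = g := by
  rw [koszulAugmentation, LinearMap.comp_apply, Submodule.mkQ_apply,
    Submodule.Quotient.mk_eq_zero, mem_irrelevantIdeal_iff] at hg
  obtain ⟨ψ, hψ, h⟩ := exists_contraction_eq_of_coeff_zero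
    (concentrated_extendCard (R := MvPolynomial V k) g) hg
    (contraction_eq_zero_of_concentrated_zero _ (concentrated_extendCard g))
  refine ⟨fun F => ψ F, extendCard_injective (R := MvPolynomial V k) 0 ?_⟩
  rw [extendCard_koszulD, extendCard_restrict hψ, h]

lemma exists_koszulD_eq_of_koszulD_eq_zero {i : ℕ}
    {g : {F : Finset V // F.card = i + 1} → MvPolynomial V k}
    (hg : koszulD (X : V → MvPolynomial V k) (MvPolynomial V k) i g = 0) :
    ∃ ψ, koszulD (X : V → MvPolynomial V k) (MvPolynomial V k) (i + 1) ψ = g := by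
  obtain ⟨ψ, hψ, h⟩ := exists_contraction_eq_of_coeff_zero
    (concentrated_extendCard (R := MvPolynomial V k) g) (by
      rw [concentrated_extendCard g ∅ (by simp), map_zero])
    (by rw [← extendCard_koszulD, hg, map_zero])
  refine ⟨fun F => ψ F, extendCard_injective (R := MvPolynomial V k) _ ?_⟩
  rw [extendCard_koszulD, extendCard_restrict hψ, h]

/-- The Koszul complex resolves the residue field. -/
def koszulResolution :
    ProjectiveResolution (ModuleCat.of (MvPolynomial V k)
      (MvPolynomial V k ⧸ irrelevantIdeal k V)) where
  complex := koszulComplex (X : V → MvPolynomial V k) (MvPolynomial V k)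
  projective i := by
    change Projective (ModuleCat.of (MvPolynomial V k)
      ({F : Finset V // F.card = i} → MvPolynomial V k))
    exact (IsProjective.iff_projective _).1 inferInstance
  π := (ChainComplex.toSingle₀Equiv _ _).symm ⟨ModuleCat.ofHom (koszulAugmentation k V), by
    rw [koszulComplex_d]
    exact ofHom_koszulD_comp_koszulAugmentation k V⟩
  quasiIso := ⟨fun n => by
    cases n with
    | zero =>
      rw [ChainComplex.quasiIsoAt₀_iff, ShortComplex.quasiIso_iff_of_zeros']
      · have he : (ShortComplex.mk _ _ (ofHom_koszulD_comp_koszulAugmentation k V)).Exact := by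
          rw [ShortComplex.moduleCat_exact_iff]
          exact fun g hg => exists_koszulD_eq_of_koszulAugmentation k V hg
        have hs : Epi (ModuleCat.ofHom (koszulAugmentation k V)) := by
          rw [ModuleCat.epi_iff_surjective]
          intro y
          obtain ⟨p, rfl⟩ := Submodule.mkQ_surjective _ y
          exact ⟨fun _ => p, rfl⟩
        -- The two short complexes have the same objects, and their maps agree only propositionally,
        -- so exactness is transported along an isomorphism built from identities.
        refine (ShortComplex.exact_and_epi_g_iff_of_iso ?_).2 ⟨he, hs⟩
        exact ShortComplex.isoMk (Iso.refl _) (Iso.refl _) (Iso.refl _)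
          ((Category.id_comp _).trans ((koszulComplex_d _ _ 0).symm.trans
            (Category.comp_id _).symm))
          ((Category.id_comp _).trans ((ChainComplex.toSingle₀Equiv_symm_apply_f_zero
            (C := koszulComplex (X : V → MvPolynomial V k) (MvPolynomial V k))
            (X := ModuleCat.of (MvPolynomial V k) (MvPolynomial V k ⧸ irrelevantIdeal k V))
            (ModuleCat.ofHom (koszulAugmentation k V)) _).symm.trans (Category.comp_id _).symm))
      all_goals rfl
    | succ n =>
      rw [quasiIsoAt_iff_exactAt']
      · rw [HomologicalComplex.exactAt_iff' _ (n + 1 + 1) (n + 1) n (by simp) (by simp),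
          ShortComplex.moduleCat_exact_iff]
        intro g hg
        change ((koszulComplex _ _).d _ _).hom _ = 0 at hg
        rw [koszulComplex_d] at hg
        change ∃ ψ, ((koszulComplex _ _).d _ _).hom ψ = g
        rw [koszulComplex_d]
        exact exists_koszulD_eq_of_koszulD_eq_zero k V hg
      · apply ChainComplex.exactAt_succ_single_obj⟩

lemma koszulResolution_π_f_zero :
    (koszulResolution k V).π.f 0 = ModuleCat.ofHom (koszulAugmentation k V) :=
  ChainComplex.toSingle₀Equiv_symm_apply_f_zero _ _

lemma koszulResolution_complex_d (i : ℕ) :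
    (koszulResolution k V).complex.d (i + 1) i =
      ModuleCat.ofHom (koszulD (X : V → MvPolynomial V k) (MvPolynomial V k) i) :=
  koszulComplex_d _ _ _

end Resolution

/-! ### Koszul modules with coefficients -/

section Tensor

variable {R : Type u} [CommRing R] {V : Type v} [LinearOrder V] [Fintype V]
  (x : V → R) (A : Type w) [AddCommGroup A] [Module R A]

/-- Tensoring the free Koszul modules with `A`. -/
def koszulTensorEquiv (i : ℕ) : A ⊗[R] ({F : Finset V // F.card = i} → R) ≃ₗ[R]
    ({F : Finset V // F.card = i} → A) :=
  TensorProduct.piScalarRight R R A _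

lemma koszulTensorEquiv_tmul {i : ℕ} (m : A) (g : {F : Finset V // F.card = i} → R)
    (F : {F : Finset V // F.card = i}) : koszulTensorEquiv A i (m ⊗ₜ g) F = g F • m := by
  simp [koszulTensorEquiv]

lemma koszulTensorEquiv_lTensor {i : ℕ} (t : A ⊗[R] ({F : Finset V // F.card = i + 1} → R)) :
    koszulTensorEquiv A i ((koszulD x R i).lTensor A t) =
      koszulD x A i (koszulTensorEquiv A (i + 1) t) := by
  induction t with
  | zero => simp
  | add a b ha hb => simp only [map_add, ha, hb]
  | tmul m g =>
    ext F
    rw [LinearMap.lTensor_tmul, koszulTensorEquiv_tmul]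
    -- On a pure tensor the claim is naturality of the differential along `r ↦ r • m`.
    have h := koszulD_map x (LinearMap.toSpanSingleton R A m) g F
    rw [LinearMap.toSpanSingleton_apply] at h
    rw [← h]
    congr 1
end Tensor

/-! ### Tor as Koszul homology -/

section KoszulHomology

variable {k : Type u} [Field k] {V : Type v} [LinearOrder V] [Fintype V]

/-- The cycles of the Koszul complex with coefficients in `A`. -/
def koszulCycles (k : Type u) [Field k] (V : Type v) [LinearOrder V] [Fintype V]
    (A : Type w) [AddCommGroup A] [Module (MvPolynomial V k) A] (i : ℕ) :
    Submodule (MvPolynomial V k) ({F : Finset V // F.card = i} → A) :=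
  LinearMap.ker (contraction (X : V → MvPolynomial V k) ∘ₗ extendCard (MvPolynomial V k) V A i)

/-- The tensor product of a module with the Koszul resolution of the residue field. -/
abbrev tensorKoszul (A : ModuleCat.{max u v} (MvPolynomial V k)) :
    ChainComplex (ModuleCat.{max u v} (MvPolynomial V k)) ℕ :=
  (((tensoringLeft _).obj A).mapHomologicalComplex _).obj (koszulResolution k V).complex

lemma tensorKoszul_d_apply (A : ModuleCat.{max u v} (MvPolynomial V k)) (i : ℕ)
    (t : A ⊗[MvPolynomial V k] ({F : Finset V // F.card = i + 1} → MvPolynomial V k)) :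
    koszulTensorEquiv (R := MvPolynomial V k) (V := V) A i (((tensorKoszul A).d (i + 1) i).hom t) =
      koszulD (X : V → MvPolynomial V k) A i
        (koszulTensorEquiv (R := MvPolynomial V k) (V := V) A (i + 1) t) := by
  rw [← koszulTensorEquiv_lTensor]
  congr 1
  have h : (tensorKoszul A).d (i + 1) i =
      A ◁ ModuleCat.ofHom (koszulD (X : V → MvPolynomial V k) (MvPolynomial V k) i) :=
    congrArg (A ◁ ·) (koszulResolution_complex_d k V i)
  rw [h]
  rfl

/-- The map `g` of `C.sc i` ends in degree `next i`; a free index `j` makes the substitution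
possible. `exists_sc_f_eq_iff` plays the same role for `prev`. -/
lemma d_next_apply_eq_zero_iff {R : Type u} [Ring R] (C : ChainComplex (ModuleCat.{v} R) ℕ)
    (i j : ℕ) (h : (ComplexShape.down ℕ).next i = j) (t : C.X i) :
    (C.sc i).g.hom t = 0 ↔ (C.d i j).hom t = 0 := by
  subst h
  rfl

lemma mem_koszulCycles_iff (A : ModuleCat.{max u v} (MvPolynomial V k)) (i : ℕ)
    (t : A ⊗[MvPolynomial V k] ({F : Finset V // F.card = i} → MvPolynomial V k)) :
    koszulTensorEquiv (R := MvPolynomial V k) (V := V) A i t ∈ koszulCycles k V A i ↔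
      ((tensorKoszul A).sc i).g.hom t = 0 := by
  cases i with
  | zero =>
    refine iff_of_true ?_ ?_
    · exact contraction_eq_zero_of_concentrated_zero _ (concentrated_extendCard _)
    · refine (d_next_apply_eq_zero_iff (tensorKoszul A) 0 0 (by simp) t).2 ?_
      rw [(tensorKoszul A).shape 0 0 (by simp)]
      rfl
  | succ n =>
    refine Iff.trans ?_ (d_next_apply_eq_zero_iff (tensorKoszul A) (n + 1) n (by simp) t).symm
    rw [koszulCycles, LinearMap.mem_ker, LinearMap.comp_apply, ← extendCard_koszulD,
      (extendCard_injective (R := MvPolynomial V k) n).eq_iff' (map_zero _),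
      ← tensorKoszul_d_apply]
    exact (koszulTensorEquiv (R := MvPolynomial V k) (V := V) A n).map_eq_zero_iff

lemma exists_sc_f_eq_iff (C : ChainComplex (ModuleCat.{max u v} (MvPolynomial V k)) ℕ) (i j : ℕ)
    (h : (ComplexShape.down ℕ).prev i = j) (t : C.X i) :
    (∃ y, (C.sc i).f.hom y = t) ↔ ∃ y, (C.d j i).hom y = t := by
  subst h
  rfl

/-- `Tor` against the residue field is computed by the Koszul complex. -/
lemma exists_koszulCycles_to_tor (A : ModuleCat.{max u v} (MvPolynomial V k)) (i : ℕ) :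
    ∃ p : koszulCycles k V A i →ₗ[MvPolynomial V k]
      ((Tor (ModuleCat.{max u v} (MvPolynomial V k)) i).obj A).obj
        (ModuleCat.of (MvPolynomial V k) (MvPolynomial V k ⧸ irrelevantIdeal k V)),
      Function.Surjective p ∧ ∀ z, p z = 0 ↔
        ∃ ψ, koszulD (X : V → MvPolynomial V k) A i ψ = z.1 := by
  obtain ⟨p, hp, hp0⟩ := exists_surjective_to_homology ((tensorKoszul A).sc i)
  let e := ((koszulResolution k V).isoLeftDerivedObj ((tensoringLeft _).obj A) i).toLinearEquiv.symm
  let q : koszulCycles k V A i →ₗ[MvPolynomial V k] LinearMap.ker ((tensorKoszul A).sc i).g.hom :=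
    LinearMap.codRestrict _
      ((koszulTensorEquiv (R := MvPolynomial V k) (V := V) A i).symm.toLinearMap ∘ₗ
        Submodule.subtype _)
      fun z => (mem_koszulCycles_iff A i _).1 (by
        change koszulTensorEquiv (R := MvPolynomial V k) (V := V) A i
          ((koszulTensorEquiv (R := MvPolynomial V k) (V := V) A i).symm _) ∈ _
        rw [LinearEquiv.apply_symm_apply]
        exact z.2)
  have hq : Function.Surjective q := by
    intro t
    refine ⟨⟨koszulTensorEquiv (R := MvPolynomial V k) (V := V) A i t.1,
      (mem_koszulCycles_iff A i _).2 t.2⟩, Subtype.ext ?_⟩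
    exact (koszulTensorEquiv (R := MvPolynomial V k) (V := V) A i).symm_apply_apply _
  refine ⟨e.toLinearMap ∘ₗ p ∘ₗ q, e.surjective.comp (hp.comp hq), fun z => ?_⟩
  change e (p (q z)) = 0 ↔ _
  refine ((e.map_eq_zero_iff.trans (hp0 _)).trans
    (exists_sc_f_eq_iff (tensorKoszul A) i (i + 1) (by simp)
      ((koszulTensorEquiv (R := MvPolynomial V k) (V := V) A i).symm z.1))).trans ?_
  constructor
  · rintro ⟨y, hy⟩
    refine ⟨koszulTensorEquiv (R := MvPolynomial V k) (V := V) A (i + 1) y, ?_⟩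
    exact (tensorKoszul_d_apply A i y).symm.trans ((congrArg
      (koszulTensorEquiv (R := MvPolynomial V k) (V := V) A i) hy).trans
        (LinearEquiv.apply_symm_apply _ _))
  · rintro ⟨ψ, hψ⟩
    refine ⟨(koszulTensorEquiv (R := MvPolynomial V k) (V := V) A (i + 1)).symm ψ, ?_⟩
    refine (LinearEquiv.eq_symm_apply (koszulTensorEquiv (R := MvPolynomial V k) (V := V) A i)).2 ?_
    refine (tensorKoszul_d_apply A i _).trans ?_
    rw [LinearEquiv.apply_symm_apply, hψ]

end KoszulHomology

/-! ### Homogeneous parts -/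

section DegreePart

lemma addMonoidHom_ext_of_isInternal {X Y : Type*} [AddCommGroup X] [AddCommGroup Y]
    {gr : ℕ → AddSubgroup X} (h : DirectSum.IsInternal gr) {f g : X →+ Y}
    (hfg : ∀ j, ∀ x ∈ gr j, f x = g x) : f = g := by
  ext x
  obtain ⟨d, rfl⟩ := h.2 x
  induction d using DirectSum.induction_on with
  | zero => simp
  | of j x => simpa using hfg j x x.2
  | add a b ha hb => simp only [map_add, ha, hb]

variable {k : Type u} [Field k] {V : Type v}

/-- The homogeneous parts of a linear map out of a graded module assemble to a linear map. -/
lemma exists_degreePart {X Y : Type*} [AddCommGroup X] [Module (MvPolynomial V k) X]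
    [AddCommGroup Y] [Module (MvPolynomial V k) Y] {gr : ℕ → AddSubgroup X}
    (h : DirectSum.IsInternal gr)
    (hsmul : ∀ (a b : ℕ) (f : MvPolynomial V k) (x : X), f.IsHomogeneous a → x ∈ gr b →
      f • x ∈ gr (a + b)) (proj : ℕ → Y →+ Y)
    (hproj : ∀ (a b : ℕ) (f : MvPolynomial V k) (y : Y), f.IsHomogeneous a →
      proj (a + b) (f • y) = f • proj b y) (φ : X →ₗ[MvPolynomial V k] Y) :
    ∃ φ₀ : X →ₗ[MvPolynomial V k] Y, ∀ j, ∀ x ∈ gr j, φ₀ x = proj j (φ x) := by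
  let e : (DirectSum ℕ fun j => gr j) ≃+ X :=
    AddEquiv.ofBijective (DirectSum.coeAddMonoidHom gr) h
  let f₀ : X →+ Y := (DirectSum.toAddMonoid fun j =>
    ((proj j).comp φ.toAddMonoidHom).comp (gr j).subtype).comp e.symm.toAddMonoidHom
  have hf₀ : ∀ j, ∀ x ∈ gr j, f₀ x = proj j (φ x) := by
    intro j x hx
    have : e.symm x = DirectSum.of (fun j => gr j) j ⟨x, hx⟩ := by
      rw [AddEquiv.symm_apply_eq]
      exact (DirectSum.coeAddMonoidHom_of gr j ⟨x, hx⟩).symm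
    change DirectSum.toAddMonoid _ (e.symm x) = _
    rw [this, DirectSum.toAddMonoid_of]
    rfl
  refine ⟨{ f₀ with map_smul' := fun f x => ?_ }, hf₀⟩
  change f₀ (f • x) = f • f₀ x
  -- Linearity need only be checked for homogeneous scalars, and then on homogeneous elements.
  rw [← sum_homogeneousComponent f, Finset.sum_smul, Finset.sum_smul, map_sum]
  refine Finset.sum_congr rfl fun a _ => ?_
  have hp := homogeneousComponent_isHomogeneous a f
  revert hp
  generalize homogeneousComponent a f = p
  intro hp
  refine DFunLike.congr_fun (addMonoidHom_ext_of_isInternal h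
    (f := f₀.comp (DistribSMul.toAddMonoidHom X p))
    (g := (DistribSMul.toAddMonoidHom Y p).comp f₀) fun j x hx => ?_) x
  change f₀ (p • x) = p • f₀ x
  rw [hf₀ _ _ (hsmul a j p x hp hx), hf₀ j x hx, map_smul, hproj a j p _ hp]

/-- The part of degree `j` of a polynomial which is the coefficient of a basis vector of
degree `i`. -/
def shiftedPart (k : Type u) [Field k] (V : Type v) (i j : ℕ) :
    MvPolynomial V k →ₗ[k] MvPolynomial V k :=
  if i ≤ j then homogeneousComponent (j - i) else 0

lemma shiftedPart_mul {i a b : ℕ} {f : MvPolynomial V k} (hf : f.IsHomogeneous a)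
    (p : MvPolynomial V k) :
    shiftedPart k V i (a + b) (f * p) = f * shiftedPart k V i b p := by
  have hf' : f ∈ homogeneousSubmodule V k a := hf
  let : GradedAlgebra (homogeneousSubmodule V k) := gradedAlgebra
  have hdec (q : MvPolynomial V k) (n : ℕ) :
      homogeneousComponent n q = DirectSum.decompose (homogeneousSubmodule V k) q n :=
    (decomposition.decompose'_apply q n).symm
  rw [shiftedPart, shiftedPart]
  by_cases hb : i ≤ b
  · rw [if_pos hb, if_pos (by omega), hdec, hdec, Nat.add_sub_assoc hb,
      DirectSum.coe_decompose_mul_add_of_left_mem _ hf']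
  · rw [if_neg hb]
    split_ifs with h
    · rw [hdec, DirectSum.coe_decompose_mul_of_left_mem_of_not_le _ hf' (by omega),
        LinearMap.zero_apply, mul_zero]
    · simp

/-- The shift by exterior degree makes the Koszul differential preserve degrees: a factor `X v` is
gained while one basis element is lost. -/
lemma shiftedPart_X_mul (i j : ℕ) (v : V) (p : MvPolynomial V k) :
    shiftedPart k V i j (X v * p) = X v * shiftedPart k V (i + 1) j p := by
  cases j with
  | zero =>
    rw [shiftedPart, shiftedPart, if_neg (by omega : ¬ i + 1 ≤ 0)]
    split_ifs with h
    -- Only `i = 0` remains, where the constant term of `X v * p` vanishes.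
    · rw [Nat.zero_sub, homogeneousComponent_zero, ← constantCoeff_eq]
      simp
    · simp
  | succ j =>
    rw [add_comm j 1, shiftedPart_mul (isHomogeneous_X k v)]
    congr 2
    simp only [shiftedPart]
    congr 1
    · simp [add_comm 1 j]
    · rw [add_comm 1 j, Nat.add_sub_add_right]

/-- The homogeneous part of degree `j` in the Koszul module of exterior degree `i`. -/
def koszulPart (k : Type u) [Field k] (V : Type v) (i j : ℕ) :
    ({F : Finset V // F.card = i} → MvPolynomial V k) →+
      ({F : Finset V // F.card = i} → MvPolynomial V k) :=
  AddMonoidHom.mk' (fun g F => shiftedPart k V i j (g F)) fun g h => by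
    ext1 F
    exact map_add _ _ _

lemma koszulPart_smul {i : ℕ} (a b : ℕ) (f : MvPolynomial V k)
    (g : {F : Finset V // F.card = i} → MvPolynomial V k) (hf : f.IsHomogeneous a) :
    koszulPart k V i (a + b) (f • g) = f • koszulPart k V i b g :=
  funext fun F => shiftedPart_mul hf (g F)

lemma koszulPart_koszulD [LinearOrder V] [Fintype V] (i j : ℕ)
    (g : {F : Finset V // F.card = i + 1} → MvPolynomial V k) :
    koszulPart k V i j (koszulD (X : V → MvPolynomial V k) _ i g) =
      koszulD (X : V → MvPolynomial V k) _ i (koszulPart k V (i + 1) j g) := by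
  ext1 F
  change shiftedPart k V i j _ = _
  rw [koszulD_apply, koszulD_apply, contraction_apply, contraction_apply, map_sum]
  refine Finset.sum_congr rfl fun v _ => ?_
  rw [map_zsmul, smul_eq_mul, shiftedPart_X_mul, smul_eq_mul]
  congr 2
  simp only [extendCard, LinearMap.coe_mk, AddHom.coe_mk]
  split_ifs
  · rfl
  · simp

end DegreePart

/-! ### Comparing graded resolutions, and the vanishing of Tor in degree `(i, i)` -/

section GradedComparison

variable {k : Type u} [Field k] {V : Type v} [LinearOrder V] [Fintype V]

/-- The residue field lives in degree zero: for `j > 0` both sides are zero, and for `j = 0` the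
constant term is kept. This keeps the homogeneous part of a comparison map compatible with the
augmentations. -/
lemma koszulAugmentation_koszulPart (j : ℕ)
    (g : {F : Finset V // F.card = 0} → MvPolynomial V k)
    (hg : koszulAugmentation k V g ∈ quotientDegree (irrelevantIdeal k V) j) :
    koszulAugmentation k V (koszulPart k V 0 j g) = koszulAugmentation k V g := by
  obtain ⟨q, hq, hqg⟩ := hg
  set p := g ⟨∅, rfl⟩ with hp
  change Ideal.Quotient.mk _ q = Ideal.Quotient.mk _ p at hqg
  change Ideal.Quotient.mk _ (shiftedPart k V 0 j p) = Ideal.Quotient.mk _ p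
  rw [Ideal.Quotient.eq, mem_irrelevantIdeal_iff] at hqg ⊢
  have hq' : homogeneousComponent j q = q := by
    have := homogeneousComponent_of_mem (m := j) (n := j) hq
    simpa using this
  rw [shiftedPart, if_pos (Nat.zero_le j), Nat.sub_zero]
  rw [map_sub, sub_eq_zero] at hqg ⊢
  rw [constantCoeff_eq] at hqg ⊢
  rw [coeff_homogeneousComponent]
  split_ifs with h
  · rfl
  · rw [← hqg, ← hq', coeff_homogeneousComponent, if_neg h]

/-- A graded projective resolution of the residue field maps to the Koszul resolution by a chain
map over the identity which preserves degrees. -/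
lemma exists_graded_comparison
    (P : GradedResolution (ModuleCat.of (MvPolynomial V k)
      (MvPolynomial V k ⧸ irrelevantIdeal k V)) (quotientDegree (irrelevantIdeal k V))) :
    ∃ φ : P.res.complex ⟶ (koszulResolution k V).complex,
      φ.f 0 ≫ (koszulResolution k V).π.f 0 = P.res.π.f 0 ≫ 𝟙 _ ∧
      ∀ i j, ∀ x ∈ P.gr i j, ∃ g : {F : Finset V // F.card = i} → MvPolynomial V k,
        (φ.f i).hom x = koszulPart k V i j g := by
  let ψ := ProjectiveResolution.lift (𝟙 _) P.res (koszulResolution k V)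
  have hψ : ψ.f 0 ≫ (koszulResolution k V).π.f 0 = P.res.π.f 0 := by
    exact (ProjectiveResolution.lift_commutes_zero (𝟙 _) P.res (koszulResolution k V)).trans
      (Category.comp_id _)
  -- The lift `ψ` need not preserve degrees; its degree-preserving part does, and is still a chain
  -- map over the identity.
  have h (i : ℕ) := exists_degreePart (P.isInternal i) (P.smul_mem i) (koszulPart k V i)
    (fun a b f g hf => koszulPart_smul a b f g hf) (ψ.f i).hom
  choose φ₀ hφ₀ using h
  refine ⟨ChainComplex.ofHom (fun i => ModuleCat.ofHom (φ₀ i)) fun i => ?_, ?_, ?_⟩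
  · rw [koszulResolution_complex_d]
    refine ModuleCat.hom_ext (LinearMap.toAddMonoidHom_injective
      (addMonoidHom_ext_of_isInternal (P.isInternal (i + 1)) fun j x hx => ?_))
    change koszulD _ _ i (φ₀ (i + 1) x) = φ₀ i ((P.res.complex.d (i + 1) i).hom x)
    rw [hφ₀ _ _ _ hx, hφ₀ _ _ _ (P.d_mem i j x hx)]
    have hc := congrArg (fun f => f.hom x) (ψ.comm (i + 1) i)
    rw [koszulResolution_complex_d] at hc
    change koszulD _ _ i ((ψ.f (i + 1)).hom x) =
      (ψ.f i).hom ((P.res.complex.d (i + 1) i).hom x) at hc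
    exact (koszulPart_koszulD i j _).symm.trans (congrArg (koszulPart k V i j) hc)
  · rw [Category.comp_id, koszulResolution_π_f_zero]
    refine ModuleCat.hom_ext (LinearMap.toAddMonoidHom_injective
      (addMonoidHom_ext_of_isInternal (P.isInternal 0) fun j x hx => ?_))
    change koszulAugmentation k V (φ₀ 0 x) = (P.res.π.f 0).hom x
    have hc := congrArg (fun f => f.hom x) hψ
    rw [koszulResolution_π_f_zero] at hc
    change koszulAugmentation k V ((ψ.f 0).hom x) = (P.res.π.f 0).hom x at hc
    rw [hφ₀ _ _ _ hx, ← hc]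
    refine koszulAugmentation_koszulPart j _ ?_
    exact hc ▸ P.π_mem j x hx
  · intro i j x hx
    exact ⟨_, hφ₀ i j x hx⟩

/-- A cycle of exterior degree `i > 0` with constant coefficients vanishes, if the ideal contains
no linear forms. -/
lemma eq_zero_of_mem_koszulCycles {J : Ideal (MvPolynomial V k)}
    (hJ : ∀ p ∈ J, ∀ v, coeff (Finsupp.single v 1) p = 0) {i : ℕ} (hi : 0 < i)
    {g : {F : Finset V // F.card = i} → MvPolynomial V k ⧸ J}
    (hg : g ∈ koszulCycles k V (MvPolynomial V k ⧸ J) i)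
    (hconst : ∀ F, ∃ c : k, g F = Ideal.Quotient.mk J (C c)) : g = 0 := by
  choose c hc using hconst
  have hext : extendCard (MvPolynomial V k) V (MvPolynomial V k ⧸ J) i g =
      fun F => Ideal.Quotient.mk J (C (extendCard k V k i c F)) := by
    ext1 F
    simp only [extendCard, LinearMap.coe_mk, AddHom.coe_mk]
    split_ifs <;> simp [hc]
  ext1 ⟨F, hF⟩
  obtain ⟨v, hv⟩ := Finset.card_pos.1 (hF ▸ hi : 0 < F.card)
  have h := congrFun hg (F.erase v)
  rw [LinearMap.comp_apply, hext, contraction_apply, Pi.zero_apply] at h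
  have h' : Ideal.Quotient.mk J (∑ u ∈ (F.erase v)ᶜ, koszulSign u (F.erase v) •
      (X u * C (extendCard k V k i c (insert u (F.erase v))))) = 0 := by
    rw [map_sum, ← h]
    refine Finset.sum_congr rfl fun u _ => ?_
    rw [map_zsmul]
    rfl
  -- The cycle condition at `F.erase v` is a linear form in `J`. Its coefficient at `x_v` comes only
  -- from adding `v` back, so it equals the constant at `F` up to sign.
  have h1 := hJ _ (Ideal.Quotient.eq_zero_iff_mem.1 h') v
  rw [coeff_sum, Finset.sum_eq_single_of_mem v (by simp)] at h1
  · rw [Finset.insert_erase hv, zsmul_eq_mul, ← map_intCast (C : k →+* MvPolynomial V k),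
      coeff_C_mul, mul_comm (X v), coeff_C_mul, coeff_X, if_pos rfl, mul_one] at h1
    have h2 : ((koszulSign v (F.erase v) : ℤ) : k) ≠ 0 := by simp [koszulSign]
    have h3 := (mul_eq_zero.1 h1).resolve_left h2
    rw [extendCard_apply_coe (R := k) c ⟨F, hF⟩] at h3
    rw [hc, h3]
    simp
  · intro u _ huv
    rw [zsmul_eq_mul, ← map_intCast (C : k →+* MvPolynomial V k),
      coeff_C_mul, mul_comm (X u), coeff_C_mul, coeff_X, if_neg, mul_zero, mul_zero]
    simpa [Finsupp.single_left_inj] using huv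

/-- The tensors of degree `i` in `S/J ⊗ P_i` are mapped to tensors with constant coefficients. -/
lemma exists_constant_of_mem_tensorDegree {J : Ideal (MvPolynomial V k)} {i : ℕ} {X : Type*}
    [AddCommGroup X] [Module (MvPolynomial V k) X] {gr : ℕ → AddSubgroup X}
    (φ : X →ₗ[MvPolynomial V k] ({F : Finset V // F.card = i} → MvPolynomial V k))
    (hφ : ∀ j, ∀ x ∈ gr j, ∃ g : {F : Finset V // F.card = i} → MvPolynomial V k,
      φ x = koszulPart k V i j g)
    {t : (MvPolynomial V k ⧸ J) ⊗[MvPolynomial V k] X}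
    (ht : t ∈ tensorDegree (quotientDegree J) gr i) (F : {F : Finset V // F.card = i}) :
    ∃ c : k, koszulTensorEquiv (R := MvPolynomial V k) (MvPolynomial V k ⧸ J) i
      (φ.lTensor (MvPolynomial V k ⧸ J) t) F = Ideal.Quotient.mk J (C c) := by
  refine AddSubgroup.closure_induction ?_ ?_ ?_ ?_ ht
  · rintro _ ⟨a, b, hab, m, ⟨p, hp, rfl⟩, x, hx, rfl⟩
    obtain ⟨g, hg⟩ := hφ b x hx
    rw [LinearMap.lTensor_tmul, koszulTensorEquiv_tmul, hg]
    change ∃ c, shiftedPart k V i b (g F) • Ideal.Quotient.mk J p = _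
    rw [shiftedPart]
    -- A nonzero part needs `i ≤ b`, which together with `a + b = i` forces `b = i` and `a = 0`;
    -- both factors are then constants.
    split_ifs with h
    · obtain rfl : b = i := by omega
      obtain rfl : a = 0 := by omega
      have hp' := (totalDegree_eq_zero_iff_eq_C).1 (Nat.le_zero.1 (IsHomogeneous.totalDegree_le hp))
      rw [hp', Nat.sub_self, homogeneousComponent_zero]
      exact ⟨coeff 0 (g F) * coeff 0 p, by rw [map_mul, map_mul]; rfl⟩
    · exact ⟨0, by simp⟩
  · refine ⟨0, ?_⟩
    rw [LinearMap.map_zero, LinearEquiv.map_zero, C_0, RingHom.map_zero, Pi.zero_apply]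
  · rintro s t _ _ ⟨c, hc⟩ ⟨d, hd⟩
    refine ⟨c + d, ?_⟩
    rw [map_add, map_add, map_add, map_add, ← hc, ← hd]
    rfl
  · rintro t _ ⟨c, hc⟩
    refine ⟨-c, ?_⟩
    rw [map_neg, map_neg, map_neg, map_neg, ← hc]
    rfl

/-- `Tor_i(S/J, k)_i` vanishes for `i > 0` if `J` contains no linear forms. -/
lemma torDegree_self_eq_bot {J : Ideal (MvPolynomial V k)}
    (hJ : ∀ p ∈ J, ∀ v, coeff (Finsupp.single v 1) p = 0) {i : ℕ} (hi : 0 < i) :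
    torDegree (ModuleCat.of (MvPolynomial V k) (MvPolynomial V k ⧸ J))
      (ModuleCat.of (MvPolynomial V k) (MvPolynomial V k ⧸ irrelevantIdeal k V))
      (quotientDegree J) (quotientDegree (irrelevantIdeal k V)) i i = ⊥ := by
  rw [torDegree, Submodule.span_eq_bot]
  rintro _ ⟨P, z, hz, rfl⟩
  obtain ⟨φ, hφ, hgr⟩ := exists_graded_comparison P
  let A := ModuleCat.of (MvPolynomial V k) (MvPolynomial V k ⧸ J)
  let Φ := (((tensoringLeft (ModuleCat.{max u v} (MvPolynomial V k))).obj A).mapHomologicalComplex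
    (ComplexShape.down ℕ)).map φ
  -- The comparison map turns `z` into a Koszul cycle with constant coefficients, and such a cycle
  -- is zero.
  have hcyc : (HomologicalComplex.cyclesMap Φ i).hom z = 0 := by
    apply (ModuleCat.mono_iff_injective ((tensorKoszul A).iCycles i)).1 inferInstance
    rw [map_zero]
    set t := ((tensorKoszul A).iCycles i).hom ((HomologicalComplex.cyclesMap Φ i).hom z) with ht
    have h1 : t = (Φ.f i).hom ((((((tensoringLeft _).obj A).mapHomologicalComplex _).obj
        P.res.complex).iCycles i).hom z) :=
      congrArg (fun f => f.hom z) (HomologicalComplex.cyclesMap_i Φ i)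
    have h2 : ((tensorKoszul A).sc i).g.hom t = 0 :=
      congrArg (fun f => f.hom ((HomologicalComplex.cyclesMap Φ i).hom z))
        ((tensorKoszul A).iCycles_d i ((ComplexShape.down ℕ).next i))
    refine (koszulTensorEquiv (R := MvPolynomial V k) (V := V) A i).map_eq_zero_iff.1 ?_
    refine eq_zero_of_mem_koszulCycles hJ hi ((mem_koszulCycles_iff A i t).2 h2) fun F => ?_
    rw [h1]
    exact exists_constant_of_mem_tensorDegree (φ.f i).hom (hgr i) hz F
  -- Naturality lets the class of `z` in `Tor` be computed from its image in the Koszul complex.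
  have hnat := ProjectiveResolution.isoLeftDerivedObj_inv_naturality (𝟙 _) P.res
    (koszulResolution k V) φ hφ ((tensoringLeft _).obj A) i
  rw [CategoryTheory.Functor.map_id, Category.comp_id] at hnat
  rw [hnat]
  have hπ : (HomologicalComplex.homologyMap Φ i).hom
      (((((((tensoringLeft _).obj A).mapHomologicalComplex _).obj
        P.res.complex).homologyπ i).hom z)) = 0 := by
    refine (congrArg (fun f => f.hom z) (HomologicalComplex.homologyπ_naturality Φ i)).trans ?_
    exact (congrArg ((tensorKoszul A).homologyπ i).hom hcyc).trans (map_zero _)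
  exact (congrArg ((koszulResolution k V).isoLeftDerivedObj
    ((tensoringLeft _).obj A) i).inv.hom hπ).trans (map_zero _)

end GradedComparison

/-! ### Koszul homology as a sum over squarefree strands -/

section Strands

variable (k : Type u) [Field k] {V : Type v} [LinearOrder V] [Fintype V]

/-- The chains of exterior degree `i` of the strand supported on `D`. -/
def strandChains (D : Finset V → Prop) (i : ℕ) : Submodule k (Finset V → k) where
  carrier := {φ | (∀ F, ¬ D F → φ F = 0) ∧ Concentrated i φ}
  add_mem' := fun ha hb => ⟨fun F hF => by simp [ha.1 F hF, hb.1 F hF],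
    fun F hF => by simp [ha.2 F hF, hb.2 F hF]⟩
  zero_mem' := ⟨fun _ _ => rfl, fun _ _ => rfl⟩
  smul_mem' := fun c φ h => ⟨fun F hF => by simp [h.1 F hF], fun F hF => by simp [h.2 F hF]⟩

open Classical in
/-- The differential of the strand supported on `D`. -/
def strandD (D : Finset V → Prop) : (Finset V → k) →ₗ[k] (Finset V → k) :=
  LinearMap.pi fun F => if D F then LinearMap.proj F ∘ₗ contraction (1 : V → k) else 0

variable {k}

lemma strandD_of_mem {D : Finset V → Prop} {F : Finset V} (hF : D F) (φ : Finset V → k) :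
    strandD k D φ F = contraction (1 : V → k) φ F := by
  rw [strandD, LinearMap.pi_apply, if_pos hF]
  rfl

lemma strandD_of_notMem {D : Finset V → Prop} {F : Finset V} (hF : ¬ D F) (φ : Finset V → k) :
    strandD k D φ F = 0 := by
  rw [strandD, LinearMap.pi_apply, if_neg hF]
  rfl

lemma strandD_mem_strandChains {D : Finset V → Prop} {i : ℕ} {φ : Finset V → k}
    (hφ : φ ∈ strandChains k D (i + 1)) : strandD k D φ ∈ strandChains k D i := by
  refine ⟨fun F hF => strandD_of_notMem hF φ, fun F hF => ?_⟩
  by_cases h : D F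
  · rw [strandD_of_mem h]
    exact hφ.2.contraction 1 F hF
  · exact strandD_of_notMem h φ

variable (k)

/-- The cycles of exterior degree `i` of the strand supported on `D`. -/
def strandCycles (D : Finset V → Prop) (i : ℕ) : Submodule k (Finset V → k) :=
  strandChains k D i ⊓ LinearMap.ker (strandD k D)

/-- The boundaries of exterior degree `i` of the strand supported on `D`. -/
def strandBoundaries (D : Finset V → Prop) (i : ℕ) : Submodule k (Finset V → k) :=
  (strandChains k D (i + 1)).map (strandD k D)

/-- The homology of the strand supported on `D`. -/
def strandHomology (D : Finset V → Prop) (i : ℕ) : Type (max u v) :=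
  strandCycles k D i ⧸ (strandBoundaries k D i).comap (strandCycles k D i).subtype

instance (D : Finset V → Prop) (i : ℕ) : AddCommGroup (strandHomology k D i) :=
  inferInstanceAs (AddCommGroup
    (strandCycles k D i ⧸ (strandBoundaries k D i).comap (strandCycles k D i).subtype))

instance (D : Finset V → Prop) (i : ℕ) : Module k (strandHomology k D i) :=
  inferInstanceAs (Module k
    (strandCycles k D i ⧸ (strandBoundaries k D i).comap (strandCycles k D i).subtype))

instance (D : Finset V → Prop) (i : ℕ) : Module.Finite k (strandHomology k D i) :=
  inferInstanceAs (Module.Finite k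
    (strandCycles k D i ⧸ (strandBoundaries k D i).comap (strandCycles k D i).subtype))

/-- The homology class of a cycle. -/
def strandClass (D : Finset V → Prop) (i : ℕ) : strandCycles k D i →ₗ[k] strandHomology k D i :=
  Submodule.mkQ ((strandBoundaries k D i).comap (strandCycles k D i).subtype)

lemma strandClass_surjective (D : Finset V → Prop) (i : ℕ) :
    Function.Surjective (strandClass k D i) := Submodule.mkQ_surjective _

lemma strandClass_eq_zero_iff (D : Finset V → Prop) (i : ℕ) (z : strandCycles k D i) :
    strandClass k D i z = 0 ↔ z.1 ∈ strandBoundaries k D i := Submodule.Quotient.mk_eq_zero _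

variable {k}

lemma component_mem_strandChains (B : Set (V →₀ ℕ)) (a : V →₀ ℕ) {i : ℕ}
    {g : Finset V → MvPolynomial V k} (hg : Concentrated i g) :
    component B a g ∈ strandChains k (strand B a) i :=
  ⟨fun _ hF => component_of_not_strand hF g, hg.component a⟩

lemma component_contraction_eq_strandD {B : Set (V →₀ ℕ)} (hB : IsLowerSet B) (a : V →₀ ℕ)
    (g : Finset V → MvPolynomial V k) :
    component B a (contraction (X : V → MvPolynomial V k) g) =
      strandD k (strand B a) (component B a g) := by
  ext F
  by_cases hF : strand B a F
  · rw [component_contraction hB hF, strandD_of_mem hF]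
  · rw [component_of_not_strand hF, strandD_of_notMem hF]

lemma component_sub {B : Set (V →₀ ℕ)} (a : V →₀ ℕ) (g h : Finset V → MvPolynomial V k) :
    component B a (g - h) = component B a g - component B a h := by
  ext F
  simp only [component, Pi.sub_apply, coeff_sub]
  split_ifs <;> simp

lemma component_congr {B : Set (V →₀ ℕ)} {J : Ideal (MvPolynomial V k)}
    (hJ : ∀ p, p ∈ J ↔ ∀ m ∈ B, coeff m p = 0) {g h : Finset V → MvPolynomial V k}
    (hgh : ∀ F, g F - h F ∈ J) (a : V →₀ ℕ) : component B a g = component B a h := by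
  rw [← sub_eq_zero, ← component_sub]
  exact component_eq_zero_of_mem hJ hgh a

lemma component_sum {B : Set (V →₀ ℕ)} (a : V →₀ ℕ) {ι : Type*} (s : Finset ι)
    (g : ι → Finset V → MvPolynomial V k) :
    component B a (∑ j ∈ s, g j) = ∑ j ∈ s, component B a (g j) :=
  map_sum (AddMonoidHom.mk' (component (k := k) B a) (component_add a)) g s

lemma contraction_quotient_mk (J : Ideal (MvPolynomial V k)) (g : Finset V → MvPolynomial V k)
    (F : Finset V) :
    contraction (M := MvPolynomial V k ⧸ J) (X : V → MvPolynomial V k)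
      (fun F => Ideal.Quotient.mk J (g F)) F =
      Ideal.Quotient.mk J (contraction (X : V → MvPolynomial V k) g F) := by
  rw [contraction_apply, contraction_apply, map_sum]
  exact Finset.sum_congr rfl fun v _ => by rw [map_zsmul]; rfl

lemma exists_section (J : Ideal (MvPolynomial V k)) :
    ∃ σ : (MvPolynomial V k ⧸ J) →ₗ[k] MvPolynomial V k, ∀ y, Ideal.Quotient.mk J (σ y) = y := by
  obtain ⟨σ, hσ⟩ := LinearMap.exists_rightInverse_of_surjective
    (Ideal.Quotient.mkₐ k J).toLinearMap (LinearMap.range_eq_top.2 Ideal.Quotient.mk_surjective)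
  exact ⟨σ, fun y => LinearMap.congr_fun hσ y⟩

lemma indicatorExp_injective : Function.Injective (indicatorExp : Finset V → V →₀ ℕ) := by
  intro E F h
  ext v
  have := DFunLike.congr_fun h v
  rw [indicatorExp_apply, indicatorExp_apply] at this
  by_cases h1 : v ∈ E <;> by_cases h2 : v ∈ F <;> simp_all

lemma component_sum_ofComponent {B : Set (V →₀ ℕ)} {φ : Finset V → Finset V → k}
    (hφ : ∀ W F, ¬ strand B (indicatorExp W) F → φ W F = 0) (W : Finset V) :
    component B (indicatorExp W) (∑ U, ofComponent (indicatorExp U) (φ U)) = φ W := by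
  rw [component_sum, Finset.sum_eq_single_of_mem W (Finset.mem_univ _)]
  · exact component_ofComponent_self _ (hφ W)
  · intro U _ hU
    exact component_ofComponent_of_ne (indicatorExp_injective.ne hU) _

/-- As `a v > 1`, the variable of `v` still divides the monomial paired with `F`. Moving one more
factor of it into that monomial leaves the support unchanged, and `hsq` applies. -/
lemma strand_erase_of_one_lt {B : Set (V →₀ ℕ)}
    (hsq : ∀ m ∈ B, ∀ v ∈ m.support, m + Finsupp.single v 1 ∈ B) {a : V →₀ ℕ} {v : V}
    (hv : 1 < a v) {F : Finset V} (hF : strand B a F) (hvF : v ∈ F) :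
    strand B a (F.erase v) := by
  refine ⟨(indicatorExp_mono (Finset.erase_subset v F)).trans hF.1, ?_⟩
  have h : a - indicatorExp (F.erase v) = (a - indicatorExp F) + Finsupp.single v 1 := by
    ext u
    by_cases hu : u = v
    · subst hu
      simp only [Finsupp.tsub_apply, indicatorExp_apply, Finsupp.add_apply,
        Finsupp.single_eq_same, hvF, Finset.notMem_erase, if_true, if_false]
      omega
    · simp [indicatorExp_apply, hu]
  rw [h]
  refine hsq _ hF.2 v ?_
  rw [Finsupp.mem_support_iff, Finsupp.tsub_apply, indicatorExp_apply, if_pos hvF]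
  omega

/-- Koszul homology of a quotient by a monomial ideal is the direct sum of the homologies of the
squarefree strands, if the other strands are acyclic. -/
lemma exists_koszulCycles_to_strandHomology {B : Set (V →₀ ℕ)} (hB : IsLowerSet B)
    {J : Ideal (MvPolynomial V k)} (hJ : ∀ p, p ∈ J ↔ ∀ m ∈ B, coeff m p = 0)
    (hsq : ∀ m ∈ B, ∀ v ∈ m.support, m + Finsupp.single v 1 ∈ B) (i : ℕ) :
    ∃ q : koszulCycles k V (MvPolynomial V k ⧸ J) i →ₗ[k]
        ((W : Finset V) → strandHomology k (strand B (indicatorExp W)) i),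
      Function.Surjective q ∧ ∀ z, q z = 0 ↔
        ∃ ψ, koszulD (X : V → MvPolynomial V k) (MvPolynomial V k ⧸ J) i ψ = z.1 := by
  -- Components see only coefficients at exponents in `B`, which vanish on `J`. The choice of the
  -- linear section is thus immaterial.
  obtain ⟨σ, hσ⟩ := exists_section J
  let S := MvPolynomial V k
  let lift (j : ℕ) (z : {F : Finset V // F.card = j} → S ⧸ J) : Finset V → S :=
    fun F => σ (extendCard S V (S ⧸ J) j z F)
  have hlift (j : ℕ) (z) : (fun F => Ideal.Quotient.mk J (lift j z F)) =
      extendCard S V (S ⧸ J) j z := funext fun F => hσ _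
  have hconc (j : ℕ) (z) : Concentrated j (lift j z) := fun F hF => by
    change σ _ = 0
    rw [concentrated_extendCard z F hF, map_zero]
  have hcyc (z : koszulCycles k V (S ⧸ J) i) (a : V →₀ ℕ) :
      component B a (lift i z.1) ∈ strandCycles k (strand B a) i := by
    refine ⟨component_mem_strandChains B a (hconc i z.1), ?_⟩
    refine (LinearMap.mem_ker (f := strandD k (strand B a))).2 ?_
    rw [← component_contraction_eq_strandD hB]
    refine component_eq_zero_of_mem hJ (fun F => ?_) a
    rw [← Ideal.Quotient.eq_zero_iff_mem, ← contraction_quotient_mk, hlift]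
    exact congrFun z.2 F
  let comp (W : Finset V) : koszulCycles k V (S ⧸ J) i →ₗ[k]
      strandCycles k (strand B (indicatorExp W)) i :=
    { toFun z := ⟨_, hcyc z (indicatorExp W)⟩
      map_add' y z := by
        refine Subtype.ext ((congrArg (component B (indicatorExp W)) ?_).trans
          (component_add (indicatorExp W) (lift i y.1) (lift i z.1)))
        ext1 F
        change σ _ = σ _ + σ _
        rw [← map_add]
        exact congrArg σ (congrFun (map_add (extendCard S V (S ⧸ J) i) y.1 z.1) F)
      map_smul' c z := by
        refine Subtype.ext ((congrArg (component B (indicatorExp W)) ?_).trans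
          (component_smul (indicatorExp W) c (lift i z.1)))
        ext1 F
        change σ _ = c • σ _
        rw [← map_smul]
        refine congrArg σ ?_
        simp only [extendCard, LinearMap.coe_mk, AddHom.coe_mk]
        split_ifs
        · rfl
        · exact (smul_zero c).symm }
  refine ⟨LinearMap.pi fun W => strandClass k _ i ∘ₗ comp W, ?_, fun z => ?_⟩
  · intro y
    choose φ hφ using fun W => strandClass_surjective k _ i (y W)
    let g : Finset V → S := ∑ W, ofComponent (indicatorExp W) (φ W).1
    have hg : Concentrated i g := fun F hF => by
      change (∑ W, ofComponent (indicatorExp W) (φ W).1) F = 0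
      rw [Finset.sum_apply]
      exact Finset.sum_eq_zero fun W _ => (Concentrated.ofComponent _ (φ W).2.1.2) F hF
    let z : {F : Finset V // F.card = i} → S ⧸ J := fun F => Ideal.Quotient.mk J (g F)
    have hz : extendCard S V (S ⧸ J) i z = fun F => Ideal.Quotient.mk J (g F) :=
      extendCard_restrict (g := fun F => Ideal.Quotient.mk J (g F)) fun F hF =>
        (congrArg _ (hg F hF)).trans (map_zero _)
    have hcompg (a : V →₀ ℕ) : component B a g ∈ strandCycles k (strand B a) i := by
      by_cases ha : ∃ W, indicatorExp W = a
      · obtain ⟨W, rfl⟩ := ha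
        rw [component_sum_ofComponent (fun W F hF => (φ W).2.1.1 F hF)]
        exact (φ W).2
      · rw [component_sum, Finset.sum_eq_zero]
        · exact Submodule.zero_mem _
        · intro W _
          exact component_ofComponent_of_ne (fun h => ha ⟨W, h⟩) _
    have hzc : z ∈ koszulCycles k V (S ⧸ J) i := by
      refine funext fun F => ?_
      rw [LinearMap.comp_apply, hz, contraction_quotient_mk, Pi.zero_apply,
        Ideal.Quotient.eq_zero_iff_mem]
      refine mem_of_component_eq_zero hJ (fun a => ?_) F
      rw [component_contraction_eq_strandD hB]
      exact (hcompg a).2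
    refine ⟨⟨z, hzc⟩, funext fun W => ?_⟩
    rw [← hφ W]
    refine congrArg (strandClass k _ i) (Subtype.ext ?_)
    refine Eq.trans ?_ (component_sum_ofComponent (fun W F hF => (φ W).2.1.1 F hF) W)
    refine component_congr hJ (fun F => ?_) _
    rw [← Ideal.Quotient.eq]
    exact (congrFun (hlift i z) F).trans (congrFun hz F)
  · rw [funext_iff]
    refine (forall_congr' fun W => strandClass_eq_zero_iff k _ i _).trans ?_
    change (∀ W, component B (indicatorExp W) (lift i z.1) ∈
      strandBoundaries k (strand B (indicatorExp W)) i) ↔ _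
    constructor
    · intro h
      obtain ⟨ψ, hψ, hψz⟩ := exists_contraction_of_component hB hJ (i := i) (g := lift i z.1)
          fun a => by
        -- Squarefree multidegrees are indicators of sets and are covered by the hypothesis. In any
        -- other multidegree a vertex of exponent at least two is a cone point.
        by_cases ha : ∀ v, a v ≤ 1
        · obtain ⟨W, rfl⟩ : ∃ W : Finset V, a = indicatorExp W := by
            refine ⟨a.support, ?_⟩
            ext v
            rw [indicatorExp_apply]
            have := ha v
            split_ifs with hv
            · rw [Finsupp.mem_support_iff] at hv
              omega
            · rw [Finsupp.notMem_support_iff] at hv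
              omega
          obtain ⟨ψ, hψ, hψz⟩ := h W
          exact ⟨ψ, hψ.1, hψ.2, fun F hF => by rw [← hψz, strandD_of_mem hF]⟩
        · push Not at ha
          obtain ⟨v, hv⟩ := ha
          exact exists_contraction_eq_of_cone v
            (fun F hF hvF => strand_erase_of_one_lt hsq hv hF hvF)
            (fun F hF _ => ⟨indicatorExp_le_of_erase (by rw [Finsupp.mem_support_iff]; omega) hF.1,
              hB (tsub_le_tsub_left (indicatorExp_mono (Finset.erase_subset v F)) a) hF.2⟩)
            (hcyc z a).1.1 (hcyc z a).1.2 fun F hF => by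
              rw [← strandD_of_mem hF]
              exact congrFun (hcyc z a).2 F
      refine ⟨fun F => Ideal.Quotient.mk J (ψ F), extendCard_injective (R := S) i ?_⟩
      rw [extendCard_koszulD, extendCard_restrict (g := fun F => Ideal.Quotient.mk J (ψ F))
        fun F hF => (congrArg _ (hψ F hF)).trans (map_zero _)]
      ext1 F
      rw [contraction_quotient_mk, ← hlift]
      exact (Ideal.Quotient.eq.2 (hψz F)).symm
    · rintro ⟨ψ, hψ⟩ W
      refine ⟨component B (indicatorExp W) (lift (i + 1) ψ),
        component_mem_strandChains B _ (hconc (i + 1) ψ), ?_⟩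
      rw [← component_contraction_eq_strandD hB]
      refine component_congr hJ (fun F => ?_) _
      rw [← Ideal.Quotient.eq, ← contraction_quotient_mk, hlift, ← extendCard_koszulD, hψ]
      exact (congrFun (hlift i z.1) F).symm

end Strands

/-! ### Hochster's formula -/

section StanleyReisner

variable {k : Type u} [Field k] {V : Type v} [LinearOrder V] [Fintype V]
  (Δ : AbstractSimplicialComplex V)

/-- The exponents of the monomials supported on faces. -/
def faceExps : Set (V →₀ ℕ) := {m | m.support = ∅ ∨ m.support ∈ Δ}

lemma mem_of_subset_face {E F : Finset V} (hF : F ∈ Δ) (hEF : E ⊆ F) (hE : E.Nonempty) : E ∈ Δ :=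
  (Δ.isRelLowerSet_faces hF).2 hEF hE

lemma isLowerSet_faceExps : IsLowerSet (faceExps Δ) := by
  rintro m n h hm
  have hs : n.support ⊆ m.support := Finsupp.support_mono h
  rcases Finset.eq_empty_or_nonempty n.support with h0 | h0
  · exact Or.inl h0
  · rcases hm with hm | hm
    · rw [hm, Finset.subset_empty] at hs
      exact Or.inl hs
    · exact Or.inr (mem_of_subset_face Δ hm hs h0)

lemma add_single_mem_faceExps {m : V →₀ ℕ} (hm : m ∈ faceExps Δ) {v : V} (hv : v ∈ m.support) :
    m + Finsupp.single v 1 ∈ faceExps Δ := by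
  have h : (m + Finsupp.single v 1).support = m.support := by
    ext u
    rw [Finsupp.mem_support_iff] at hv
    by_cases hu : v = u
    · subst hu
      simp [hv]
    · simp [hu]
  rw [faceExps, Set.mem_ofPred_eq, h]
  exact hm

lemma support_indicatorExp (F : Finset V) : (indicatorExp F).support = F := by
  ext v
  simp [indicatorExp_apply]

/-- Membership in a monomial ideal is tested on monomials, and `x^m` is divisible by the monomial of
a nonface exactly when the support of `m` is a nonempty nonface; the support itself is then the
witness. -/
lemma mem_stanleyReisnerIdeal_iff (p : MvPolynomial V k) :
    p ∈ stanleyReisnerIdeal k Δ ↔ ∀ m ∈ faceExps Δ, coeff m p = 0 := by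
  have h : {f : MvPolynomial V k | ∃ F : Finset V, F.Nonempty ∧ F ∉ Δ ∧ f = ∏ x ∈ F, X x} =
      (fun s => monomial s 1) '' (indicatorExp '' {F | F.Nonempty ∧ F ∉ Δ}) := by
    have hmon (F : Finset V) :
        monomial (indicatorExp F) (1 : k) = ∏ x ∈ F, (X x : MvPolynomial V k) := by
      rw [indicatorExp, monomial_sum_one]
      rfl
    ext f
    simp only [Set.mem_ofPred_eq, Set.mem_image, exists_exists_and_eq_and, hmon]
    exact ⟨fun ⟨F, h1, h2, h3⟩ => ⟨F, ⟨h1, h2⟩, h3.symm⟩,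
      fun ⟨F, ⟨h1, h2⟩, h3⟩ => ⟨F, h1, h2, h3.symm⟩⟩
  rw [stanleyReisnerIdeal, h, mem_ideal_span_monomial_image]
  simp only [Set.exists_mem_image, Set.mem_ofPred_eq, mem_support_iff]
  constructor
  · intro hp m hm
    by_contra hne
    obtain ⟨F, ⟨hF0, hF⟩, hFm⟩ := hp m hne
    have hs := Finsupp.support_mono hFm
    rw [support_indicatorExp] at hs
    rcases hm with hm | hm
    · rw [hm, Finset.subset_empty] at hs
      exact hF0.ne_empty hs
    · exact hF (mem_of_subset_face Δ hm hs hF0)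
  · intro hp m hm
    refine ⟨m.support, ⟨Finset.nonempty_iff_ne_empty.2 fun h => hm (hp m (Or.inl h)),
      fun h => hm (hp m (Or.inr h))⟩, fun v => ?_⟩
    rw [indicatorExp_apply]
    split_ifs with hv
    · exact Nat.one_le_iff_ne_zero.2 (Finsupp.mem_support_iff.1 hv)
    · exact Nat.zero_le _

/-- All singletons are faces, so the ideal contains no linear forms, as `torDegree_self_eq_bot`
requires. -/
lemma coeff_single_eq_zero {p : MvPolynomial V k} (hp : p ∈ stanleyReisnerIdeal k Δ) (v : V) :
    coeff (Finsupp.single v 1) p = 0 := by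
  refine (mem_stanleyReisnerIdeal_iff Δ p).1 hp _ (Or.inr ?_)
  rw [Finsupp.support_single v one_ne_zero]
  exact Δ.singleton_mem v

lemma gradedBetti_self_eq_zero {i : ℕ} (hi : 0 < i) : gradedBetti k Δ i i = 0 := by
  rw [gradedBetti, torDegree_self_eq_bot (fun p hp => coeff_single_eq_zero Δ hp) hi]
  exact finrank_bot k _

variable (k) in
/-- The homology of the strand of the Koszul complex in squarefree multidegree `W`. -/
abbrev faceHomology (W : Finset V) (i : ℕ) : Type (max u v) :=
  strandHomology k (strand (faceExps Δ) (indicatorExp W)) i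

lemma exists_koszulCycles_to_torSpace (J : Ideal (MvPolynomial V k)) (i : ℕ) :
    ∃ p : koszulCycles k V (MvPolynomial V k ⧸ J) i →ₗ[k] torSpace
        (ModuleCat.of (MvPolynomial V k) (MvPolynomial V k ⧸ J))
        (ModuleCat.of (MvPolynomial V k) (MvPolynomial V k ⧸ irrelevantIdeal k V)) i,
      Function.Surjective p ∧ ∀ z, p z = 0 ↔
        ∃ ψ, koszulD (X : V → MvPolynomial V k) (MvPolynomial V k ⧸ J) i ψ = z.1 := by
  obtain ⟨p, hp, hp0⟩ := exists_koszulCycles_to_tor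
    (ModuleCat.of (MvPolynomial V k) (MvPolynomial V k ⧸ J)) i
  refine ⟨{ toFun := p, map_add' := map_add p, map_smul' := fun c z => ?_ }, hp, hp0⟩
  refine Eq.trans (congrArg p ?_) (map_smul p (C c) z)
  refine Subtype.ext (funext fun F => ?_)
  change c • z.1 F = (C c : MvPolynomial V k) • z.1 F
  rw [← MvPolynomial.algebraMap_eq, algebraMap_smul]

lemma nonempty_linearEquiv_of_surjective {R M N P : Type*} [Ring R] [AddCommGroup M] [Module R M]
    [AddCommGroup N] [Module R N] [AddCommGroup P] [Module R P] {p : M →ₗ[R] N} {q : M →ₗ[R] P}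
    (hp : Function.Surjective p) (hq : Function.Surjective q) (h : ∀ z, p z = 0 ↔ q z = 0) :
    Nonempty (N ≃ₗ[R] P) :=
  ⟨((p.quotKerEquivOfSurjective hp).symm.trans
    (Submodule.quotEquivOfEq (LinearMap.ker p) (LinearMap.ker q) (Submodule.ext h))).trans
    (q.quotKerEquivOfSurjective hq)⟩

variable (k) in
lemma nonempty_torSpace_equiv (i : ℕ) :
    Nonempty (torSpace
      (ModuleCat.of (MvPolynomial V k) (MvPolynomial V k ⧸ stanleyReisnerIdeal k Δ))
      (ModuleCat.of (MvPolynomial V k) (MvPolynomial V k ⧸ irrelevantIdeal k V)) i ≃ₗ[k]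
      ((W : Finset V) → faceHomology k Δ W i)) := by
  obtain ⟨p, hp, hp0⟩ := exists_koszulCycles_to_torSpace (stanleyReisnerIdeal k Δ) i
  obtain ⟨q, hq, hq0⟩ := exists_koszulCycles_to_strandHomology (isLowerSet_faceExps Δ)
    (mem_stanleyReisnerIdeal_iff (k := k) Δ)
    (fun m hm v hv => add_single_mem_faceExps Δ hm hv) i
  have h (z) : p z = 0 ↔ q z = 0 := (hp0 z).trans (hq0 z).symm
  exact nonempty_linearEquiv_of_surjective hp hq h

/-- Finiteness of the ambient space matters here, since `finrank` of an infinite-dimensional space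
is zero. Needed only in codimension zero. -/
lemma gradedBetti_le_betti (i j : ℕ) : gradedBetti k Δ i j ≤ betti k Δ i := by
  obtain ⟨e⟩ := nonempty_torSpace_equiv k Δ i
  have : Module.Finite k (torSpace
      (ModuleCat.of (MvPolynomial V k) (MvPolynomial V k ⧸ stanleyReisnerIdeal k Δ))
      (ModuleCat.of (MvPolynomial V k) (MvPolynomial V k ⧸ irrelevantIdeal k V)) i) :=
    Module.Finite.equiv e.symm
  exact Submodule.finrank_le _

/-- Hochster's formula: the total Betti numbers are sums over the squarefree multidegrees. -/
lemma betti_eq_sum (i : ℕ) :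
    betti k Δ i = ∑ W : Finset V, Module.finrank k (faceHomology k Δ W i) := by
  obtain ⟨e⟩ := nonempty_torSpace_equiv k Δ i
  rw [betti, e.finrank_eq, Module.finrank_pi_fintype]

end StanleyReisner

/-! ### Dimension counts -/

section LinearAlgebra

variable (k : Type u) [Field k] {ι : Type v} [Fintype ι]

/-- The functions vanishing outside a finite set. -/
def supportedOn (s : Finset ι) : Submodule k (ι → k) where
  carrier := {f | ∀ x ∉ s, f x = 0}
  add_mem' := fun ha hb x hx => by simp [ha x hx, hb x hx]
  zero_mem' := fun _ _ => rfl
  smul_mem' := fun c f h x hx => by simp [h x hx]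

open Classical in
lemma finrank_supportedOn (s : Finset ι) : Module.finrank k (supportedOn k s) = s.card := by
  let e : supportedOn k s ≃ₗ[k] (s → k) :=
    { toFun f x := f.1 x
      map_add' _ _ := rfl
      map_smul' _ _ := rfl
      invFun g := ⟨fun x => if h : x ∈ s then g ⟨x, h⟩ else 0, fun x hx => dif_neg hx⟩
      left_inv f := by
        ext x
        by_cases h : x ∈ s
        · simp [h]
        · simp [h, f.2 x h]
      right_inv g := by
        ext x
        simp }
  rw [e.finrank_eq, Module.finrank_fintype_fun_eq_card, Fintype.card_coe]

variable {k}

lemma finrank_map_add_finrank_inf_ker {M N : Type*} [AddCommGroup M] [Module k M]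
    [AddCommGroup N] [Module k N] [Module.Finite k M] (p : Submodule k M) (f : M →ₗ[k] N) :
    Module.finrank k (p.map f) + Module.finrank k (p ⊓ LinearMap.ker f : Submodule k M) =
      Module.finrank k p := by
  rw [← (f.domRestrict p).finrank_range_add_finrank_ker, LinearMap.range_domRestrict,
    LinearMap.ker_domRestrict, LinearEquiv.finrank_eq (Submodule.equivMapOfInjective p.subtype
      p.injective_subtype ((LinearMap.ker f).comap p.subtype)), Submodule.map_comap_subtype]

end LinearAlgebra

/-! ### Counting components and edges -/

section GraphFunctions

variable (k : Type u) [Field k] {V : Type v} (G : SimpleGraph V)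

/-- The functions on `W` which are constant along the edges inside `W`, extended by zero. -/
def locallyConstant (W : Finset V) : Submodule k (V → k) where
  carrier := {f | (∀ v ∉ W, f v = 0) ∧ ∀ u ∈ W, ∀ v ∈ W, G.Adj u v → f u = f v}
  add_mem' := fun ha hb => ⟨fun v hv => by simp [ha.1 v hv, hb.1 v hv],
    fun u hu v hv h => by simp [ha.2 u hu v hv h, hb.2 u hu v hv h]⟩
  zero_mem' := ⟨fun _ _ => rfl, fun _ _ _ _ _ => rfl⟩
  smul_mem' := fun c f h => ⟨fun v hv => by simp [h.1 v hv],
    fun u hu v hv huv => by simp [h.2 u hu v hv huv]⟩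

/-- The number of connected components of the induced subgraph on `W`, as a dimension. -/
def componentCount (W : Finset V) : ℕ := Module.finrank k (locallyConstant k G W)

open Classical in
/-- The edges inside `W`, as sets with two elements. -/
def edgesWithin (W : Finset V) : Finset (Finset V) :=
  (W.powersetCard 2).filter fun E : Finset V => G.IsClique (E : Set V)

lemma mem_edgesWithin {W E : Finset V} :
    E ∈ edgesWithin G W ↔ E ⊆ W ∧ E.card = 2 ∧ G.IsClique (E : Set V) := by
  simp only [edgesWithin, Finset.mem_filter, Finset.mem_powersetCard, and_assoc]

/-- The number of edges inside `W`. -/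
def edgeCount (W : Finset V) : ℕ := (edgesWithin G W).card

end GraphFunctions

/-! ### The strands of a graph complex -/

section GraphStrands

variable {k : Type u} [Field k] {V : Type v} [LinearOrder V] [Fintype V]

/-- The family `D` is closed under adding elements of `W`, so truncating the differential to `D`
loses no term: sets that leave `W` carry no chain. -/
lemma strandD_strandD {D : Finset V → Prop} {W : Finset V} (hDW : ∀ F, D F → F ⊆ W)
    (hD : ∀ F, D F → ∀ v ∈ W, D (insert v F)) {i : ℕ} {φ : Finset V → k}
    (hφ : φ ∈ strandChains k D i) : strandD k D (strandD k D φ) = 0 := by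
  ext F
  by_cases hF : D F
  · rw [strandD_of_mem hF]
    refine Eq.trans ?_ (congrFun (contraction_contraction (1 : V → k) φ) F)
    rw [contraction_apply, contraction_apply]
    refine Finset.sum_congr rfl fun v _ => ?_
    by_cases hv : v ∈ W
    · rw [strandD_of_mem (hD F hF v hv)]
    · rw [strandD_of_notMem (fun h => hv (hDW _ h (Finset.mem_insert_self v F))),
        contraction_apply, Finset.sum_eq_zero]
      intro u _
      rw [hφ.1, smul_zero, smul_zero]
      exact fun h => hv (hDW _ h (Finset.mem_insert_of_mem (Finset.mem_insert_self v F)))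
  · exact strandD_of_notMem hF _

lemma finrank_strandHomology_add {D : Finset V → Prop} {W : Finset V} (hDW : ∀ F, D F → F ⊆ W)
    (hD : ∀ F, D F → ∀ v ∈ W, D (insert v F)) (i : ℕ) :
    Module.finrank k (strandHomology k D i) + Module.finrank k (strandBoundaries k D i) =
      Module.finrank k (strandCycles k D i) := by
  have hle : strandBoundaries k D i ≤ strandCycles k D i := by
    rintro _ ⟨φ, hφ, rfl⟩
    exact ⟨strandD_mem_strandChains hφ, strandD_strandD hDW hD hφ⟩
  rw [← (Submodule.comapSubtypeEquivOfLe hle).finrank_eq]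
  exact Submodule.finrank_quotient_add_finrank _

variable (G : SimpleGraph V)

/-- The members of the strand of a graph complex in squarefree multidegree `W`. -/
lemma strand_graphComplex_iff (W F : Finset V) :
    strand (faceExps (graphComplex G)) (indicatorExp W) F ↔
      F ⊆ W ∧ (W \ F).card ≤ 2 ∧ G.IsClique ((W \ F : Finset V) : Set V) := by
  have hsub : indicatorExp F ≤ indicatorExp W ↔ F ⊆ W := by
    refine ⟨fun h v hv => ?_, indicatorExp_mono⟩
    have := h v
    rw [indicatorExp_apply, indicatorExp_apply, if_pos hv] at this
    by_contra hvW
    rw [if_neg hvW] at this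
    omega
  rw [strand, hsub]
  refine and_congr_right fun hF => ?_
  have hdiff : indicatorExp W - indicatorExp F = indicatorExp (W \ F) := by
    ext v
    have := @hF v
    simp only [Finsupp.tsub_apply, indicatorExp_apply, Finset.mem_sdiff]
    split_ifs <;> first | rfl | (exfalso; tauto)
  rw [hdiff, faceExps, Set.mem_ofPred_eq, support_indicatorExp]
  constructor
  · rintro (h | h)
    · rw [h]
      simp
    · exact h.2
  · intro h
    rcases Finset.eq_empty_or_nonempty (W \ F) with h0 | h0
    · exact Or.inl h0
    · exact Or.inr ⟨h0, h⟩

lemma strand_graphComplex_insert {W F : Finset V}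
    (hF : strand (faceExps (graphComplex G)) (indicatorExp W) F) {v : V} (hv : v ∈ W) :
    strand (faceExps (graphComplex G)) (indicatorExp W) (insert v F) := by
  rw [strand_graphComplex_iff] at hF ⊢
  have h : W \ insert v F ⊆ W \ F := Finset.sdiff_subset_sdiff le_rfl (Finset.subset_insert v F)
  exact ⟨Finset.insert_subset hv hF.1, (Finset.card_le_card h).trans hF.2.1,
    hF.2.2.subset (Finset.coe_subset.2 h)⟩

/-- Abbreviation for the strand of the graph complex in squarefree multidegree `W`. -/
abbrev graphStrand (W : Finset V) : Finset V → Prop :=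
  strand (faceExps (graphComplex G)) (indicatorExp W)

lemma graphStrand_subset {W F : Finset V} (hF : graphStrand G W F) : F ⊆ W :=
  ((strand_graphComplex_iff G W F).1 hF).1

lemma card_le_of_graphStrand {W F : Finset V} (hF : graphStrand G W F) : W.card ≤ F.card + 2 := by
  have h := (strand_graphComplex_iff G W F).1 hF
  have h1 := Finset.card_sdiff_add_card_eq_card h.1
  omega

lemma graphStrand_self (W : Finset V) : graphStrand G W W := by
  rw [graphStrand, strand_graphComplex_iff]
  simp

lemma graphStrand_erase (W : Finset V) (v : V) : graphStrand G W (W.erase v) := by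
  have h : W \ W.erase v ⊆ {v} := by
    intro u hu
    simp only [Finset.mem_sdiff, Finset.mem_erase, not_and] at hu
    by_contra h
    exact hu.2 (by simpa using h) hu.1
  rw [graphStrand, strand_graphComplex_iff]
  refine ⟨Finset.erase_subset v W, (Finset.card_le_card h).trans (by simp), ?_⟩
  refine SimpleGraph.IsClique.subset (Finset.coe_subset.2 h) ?_
  simp

lemma strandChains_graphStrand_eq_bot {W : Finset V} {i : ℕ}
    (h : W.card < i ∨ i + 2 < W.card) : strandChains k (graphStrand G W) i = ⊥ := by
  rw [eq_bot_iff]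
  rintro φ ⟨h1, h2⟩
  refine (Submodule.mem_bot k).2 (funext fun F => ?_)
  by_cases hF : graphStrand G W F
  · refine h2 F ?_
    have := Finset.card_le_card (graphStrand_subset G hF)
    have := card_le_of_graphStrand G hF
    omega
  · exact h1 F hF

/-- The only possible chain sits on `F = W`, the empty face, and its boundary at `W.erase v` is its
value up to sign. This is the vanishing of reduced cohomology in degree `-1` for nonempty `W`. -/
lemma strandCycles_graphStrand_eq_bot {W : Finset V} {i : ℕ} (hi : 0 < i) (hW : W.card = i) :
    strandCycles k (graphStrand G W) i = ⊥ := by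
  rw [eq_bot_iff]
  rintro φ ⟨⟨h1, h2⟩, h3⟩
  refine (Submodule.mem_bot k).2 (funext fun F => ?_)
  by_cases hF : F = W
  · subst hF
    obtain ⟨v, hv⟩ := Finset.card_pos.1 (hW ▸ hi : 0 < F.card)
    have h := congrFun h3 (F.erase v)
    rw [strandD_of_mem (graphStrand_erase G F v), contraction_apply,
      Finset.sum_eq_single_of_mem v (by simp)] at h
    · rw [Finset.insert_erase hv] at h
      simpa [koszulSign] using h
    · intro u hu huv
      rw [h1, smul_zero, smul_zero]
      intro hu'
      have := graphStrand_subset G hu' (Finset.mem_insert_self u _)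
      simp only [Finset.mem_compl, Finset.mem_erase, not_and] at hu
      exact hu huv this
  · by_cases hFD : graphStrand G W F
    · refine h2 F fun hc => hF ?_
      exact Finset.eq_of_subset_of_card_le (graphStrand_subset G hFD) (by omega)
    · exact h1 F hFD

lemma finrank_faceHomology_eq_zero {W : Finset V} {i : ℕ} (hi : 0 < i)
    (h : W.card ≤ i ∨ i + 2 < W.card) :
    Module.finrank k (faceHomology k (graphComplex G) W i) = 0 := by
  have h0 : strandCycles k (graphStrand G W) i = ⊥ := by
    rcases h with h | h
    · rcases h.lt_or_eq with h | h
      · rw [strandCycles, strandChains_graphStrand_eq_bot G (Or.inl h), bot_inf_eq]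
      · exact strandCycles_graphStrand_eq_bot G hi h
    · rw [strandCycles, strandChains_graphStrand_eq_bot G (Or.inr h), bot_inf_eq]
  have h1 := finrank_strandHomology_add (k := k) (D := graphStrand G W)
    (fun F hF => graphStrand_subset G hF)
    (fun F hF v hv => strand_graphComplex_insert G hF hv) i
  rw [h0, finrank_bot] at h1
  exact (Nat.add_eq_zero_iff.1 h1).1

/-- The function on the vertices of `W` attached to a chain on the sets `W.erase v`. -/
def eraseTransform (k : Type u) [Field k] (W : Finset V) : (Finset V → k) →ₗ[k] (V → k) where
  toFun φ v := if v ∈ W then koszulSign v W • φ (W.erase v) else 0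
  map_add' φ ψ := by
    ext v
    simp only [Pi.add_apply]
    split_ifs <;> simp
  map_smul' c φ := by
    ext v
    simp only [Pi.smul_apply, RingHom.id_apply]
    split_ifs
    · rw [smul_comm]
    · simp

lemma eraseTransform_apply_of_mem {W : Finset V} {v : V} (hv : v ∈ W) (φ : Finset V → k) :
    eraseTransform k W φ v = koszulSign v W • φ (W.erase v) := if_pos hv

/-- The signs in `eraseTransform` are chosen so that the two terms at the complement of `{a, b}`
become a difference of values, as for the usual coboundary of a function on vertices. -/
lemma strandD_pair {W F : Finset V} {a b : V} (hab : a < b) (ha : a ∉ F) (hb : b ∉ F)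
    (hW : W = insert a (insert b F)) {D : Finset V → Prop} (hDW : ∀ F, D F → F ⊆ W) (hF : D F)
    {i : ℕ} {φ : Finset V → k} (hφ : φ ∈ strandChains k D i) :
    strandD k D φ F = (koszulSign a W * koszulSign b W) •
      (eraseTransform k W φ b - eraseTransform k W φ a) := by
  have haW : a ∈ W := by simp [hW]
  have hbW : b ∈ W := by simp [hW]
  have h1 : W.erase a = insert b F := by
    rw [hW, Finset.erase_insert]
    simp [ha, hab.ne]
  have h2 : W.erase b = insert a F := by
    rw [hW, Finset.insert_comm, Finset.erase_insert]
    simp [hb, hab.ne']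
  have h3 : koszulSign a W = koszulSign a F := by
    rw [hW, koszulSign_insert_of_not_lt (lt_irrefl a), koszulSign_insert_of_not_lt hab.not_gt]
  have h4 : koszulSign b W = -koszulSign b F := by
    rw [hW, koszulSign_insert_of_lt (by simp [ha, hab.ne]) hab,
      koszulSign_insert_of_not_lt (lt_irrefl b)]
  rw [strandD_of_mem hF, contraction_apply, eraseTransform_apply_of_mem haW,
    eraseTransform_apply_of_mem hbW, h1, h2]
  have hsum : ∑ v ∈ Fᶜ, koszulSign v F • (1 : V → k) v • φ (insert v F) =
      ∑ v ∈ {a, b}, koszulSign v F • (1 : V → k) v • φ (insert v F) := by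
    refine (Finset.sum_subset ?_ ?_).symm
    · intro v hv
      simp only [Finset.mem_insert, Finset.mem_singleton] at hv
      rcases hv with rfl | rfl <;> simpa
    · intro v hv hv'
      rw [hφ.1, smul_zero, smul_zero]
      intro hD
      have := hDW _ hD (Finset.mem_insert_self v F)
      rw [hW] at this
      simp only [Finset.mem_insert, Finset.mem_singleton, Finset.mem_compl, not_or] at *
      tauto
  rw [hsum, Finset.sum_pair hab.ne, Pi.one_apply, Pi.one_apply, one_smul, one_smul, smul_sub,
    smul_smul, smul_smul]
  have e1 : koszulSign a W * koszulSign b W * koszulSign b W = koszulSign a F := by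
    rw [mul_assoc, koszulSign_mul_self, mul_one, h3]
  have e2 : koszulSign a W * koszulSign b W * koszulSign a W = -koszulSign b F := by
    rw [mul_right_comm, koszulSign_mul_self, one_mul, h4]
  rw [e1, e2, neg_smul, sub_neg_eq_add]

lemma pair_of_graphStrand {W F : Finset V} {i : ℕ} (hW : W.card = i + 1) (hF : graphStrand G W F)
    (hFi : F.card + 1 = i) : ∃ a b, a < b ∧ a ∉ F ∧ b ∉ F ∧ W = insert a (insert b F) ∧
      G.Adj a b := by
  have h := (strand_graphComplex_iff G W F).1 hF
  have hc : (W \ F).card = 2 := by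
    have := Finset.card_sdiff_add_card_eq_card h.1
    omega
  obtain ⟨x, y, hxy, he⟩ := Finset.card_eq_two.1 hc
  have hadj : G.Adj x y := h.2.2 (by simp [he]) (by simp [he]) hxy
  have hx : x ∈ W \ F := by simp [he]
  have hy : y ∈ W \ F := by simp [he]
  rw [Finset.mem_sdiff] at hx hy
  have hWe : W = insert x (insert y F) := by
    rw [← Finset.sdiff_union_of_subset h.1, he]
    ext v
    simp
  rcases lt_or_gt_of_ne hxy with hlt | hlt
  · exact ⟨x, y, hlt, hx.2, hy.2, hWe, hadj⟩
  · exact ⟨y, x, hlt, hy.2, hx.2, by rw [hWe, Finset.insert_comm], hadj.symm⟩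

lemma koszulSign_smul_eq_zero_iff {v : V} {F : Finset V} {c : k} :
    koszulSign v F • c = 0 ↔ c = 0 := by
  simp [koszulSign]

/-- Each edge in `W` gives one cycle condition, at its complement, and by `strandD_pair` it says
that the transformed chain agrees at both ends. -/
lemma mem_strandCycles_iff {W : Finset V} {i : ℕ} (hi : 0 < i) (hW : W.card = i + 1)
    {φ : Finset V → k} (hφ : φ ∈ strandChains k (graphStrand G W) i) :
    φ ∈ strandCycles k (graphStrand G W) i ↔ eraseTransform k W φ ∈ locallyConstant k G W := by
  have hsub : ∀ F, graphStrand G W F → F ⊆ W := fun F hF => graphStrand_subset G hF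
  constructor
  · rintro ⟨-, h⟩
    refine ⟨fun v hv => if_neg hv, ?_⟩
    have key : ∀ a ∈ W, ∀ b ∈ W, G.Adj a b → a < b →
        eraseTransform k W φ a = eraseTransform k W φ b := by
      intro a ha b hb hadj hab
      have hF : graphStrand G W ((W.erase a).erase b) := by
        rw [graphStrand, strand_graphComplex_iff]
        have he : W \ (W.erase a).erase b = {a, b} := by
          ext v
          simp only [Finset.mem_sdiff, Finset.mem_erase, Finset.mem_insert, Finset.mem_singleton]
          constructor
          · tauto
          · rintro (rfl | rfl) <;> simp [ha, hb]
        rw [he]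
        refine ⟨(Finset.erase_subset _ _).trans (Finset.erase_subset _ _), Finset.card_le_two, ?_⟩
        simp [SimpleGraph.isClique_iff, Set.pairwise_insert, hadj, hadj.symm]
      have hWe : W = insert a (insert b ((W.erase a).erase b)) := by
        rw [Finset.insert_erase (by simp [hb, hab.ne']), Finset.insert_erase ha]
      have h0 := congrFun h ((W.erase a).erase b)
      rw [strandD_pair hab (by simp) (by simp) hWe hsub hF hφ, mul_smul, Pi.zero_apply,
        koszulSign_smul_eq_zero_iff, koszulSign_smul_eq_zero_iff, sub_eq_zero] at h0
      exact h0.symm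
    intro a ha b hb hadj
    rcases lt_or_gt_of_ne hadj.ne with h | h
    · exact key a ha b hb hadj h
    · exact (key b hb a ha hadj.symm h).symm
  · rintro ⟨-, h⟩
    refine ⟨hφ, funext fun F => ?_⟩
    by_cases hF : graphStrand G W F
    · by_cases hFi : F.card + 1 = i
      · obtain ⟨a, b, hab, ha, hb, hWe, hadj⟩ := pair_of_graphStrand G hW hF hFi
        rw [strandD_pair hab ha hb hWe hsub hF hφ,
          h a (by simp [hWe]) b (by simp [hWe]) hadj, sub_self, smul_zero, Pi.zero_apply]
      · rw [strandD_of_mem hF]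
        obtain ⟨j, rfl⟩ := Nat.exists_eq_add_of_lt hi
        refine Concentrated.contraction (i := j) 1 ?_ F (by omega)
        have := hφ.2
        rwa [Nat.zero_add] at this
    · exact strandD_of_notMem hF φ

/-- Chains on the sets `W.erase v` are functions on the vertices of `W`. -/
lemma eq_of_eraseTransform_eq {W : Finset V} {i : ℕ} (hW : W.card = i + 1)
    {φ ψ : Finset V → k} (hφ : φ ∈ strandChains k (graphStrand G W) i)
    (hψ : ψ ∈ strandChains k (graphStrand G W) i)
    (h : eraseTransform k W φ = eraseTransform k W ψ) : φ = ψ := by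
  rw [← sub_eq_zero, ← map_sub] at h
  have hd := Submodule.sub_mem _ hφ hψ
  rw [← sub_eq_zero]
  revert h hd
  generalize φ - ψ = χ
  intro h hd
  ext F
  by_cases hF : graphStrand G W F
  · by_cases hc : F.card = i
    · have hs := graphStrand_subset G hF
      obtain ⟨v, hv⟩ := Finset.card_eq_one.1 (show (W \ F).card = 1 by
        have := Finset.card_sdiff_add_card_eq_card hs
        omega)
      have hvW : v ∈ W := (Finset.mem_sdiff.1 (hv ▸ Finset.mem_singleton_self v : v ∈ W \ F)).1
      have he : F = W.erase v := by
        rw [← Finset.sdiff_singleton_eq_erase, ← hv, Finset.sdiff_sdiff_eq_self hs]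
      have h0 := congrFun h v
      rw [eraseTransform_apply_of_mem hvW, Pi.zero_apply, koszulSign_smul_eq_zero_iff] at h0
      rw [he, h0, Pi.zero_apply]
    · exact hd.2 F hc
  · exact hd.1 F hF

lemma exists_eraseTransform_eq {W : Finset V} {i : ℕ} (hW : W.card = i + 1) {f : V → k}
    (hf : ∀ v ∉ W, f v = 0) :
    ∃ φ ∈ strandChains k (graphStrand G W) i, eraseTransform k W φ = f := by
  classical
  refine ⟨fun F => ∑ v ∈ W, if F = W.erase v then koszulSign v W • f v else 0,
    ⟨fun F hF => ?_, fun F hF => ?_⟩, ?_⟩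
  · refine Finset.sum_eq_zero fun v _ => if_neg ?_
    rintro rfl
    exact hF (graphStrand_erase G W v)
  · refine Finset.sum_eq_zero fun v hv => if_neg ?_
    rintro rfl
    rw [Finset.card_erase_of_mem hv] at hF
    omega
  · ext v
    by_cases hv : v ∈ W
    · rw [eraseTransform_apply_of_mem hv, Finset.sum_eq_single_of_mem v hv, if_pos rfl, smul_smul,
        koszulSign_mul_self, one_smul]
      intro u hu huv
      refine if_neg fun h => huv ?_
      exact ((Finset.erase_inj W hv).1 h).symm
    · rw [hf v hv]
      exact if_neg hv

lemma finrank_strandChains {W : Finset V} {i : ℕ} (hW : W.card = i + 1) :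
    Module.finrank k (strandChains k (graphStrand G W) i) = W.card := by
  rw [← finrank_supportedOn k W]
  let T : strandChains k (graphStrand G W) i →ₗ[k] supportedOn k W :=
    LinearMap.codRestrict _ ((eraseTransform k W).domRestrict _) fun φ v hv => if_neg hv
  refine (LinearEquiv.ofBijective T ⟨fun φ ψ h => ?_, fun f => ?_⟩).finrank_eq
  · exact Subtype.ext (eq_of_eraseTransform_eq G hW φ.2 ψ.2 (congrArg Subtype.val h))
  · obtain ⟨φ, hφ, h⟩ := exists_eraseTransform_eq G hW f.2
    exact ⟨⟨φ, hφ⟩, Subtype.ext h⟩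

lemma finrank_strandCycles {W : Finset V} {i : ℕ} (hi : 0 < i) (hW : W.card = i + 1) :
    Module.finrank k (strandCycles k (graphStrand G W) i) = componentCount k G W := by
  let T : strandCycles k (graphStrand G W) i →ₗ[k] locallyConstant k G W :=
    LinearMap.codRestrict _ ((eraseTransform k W).domRestrict _) fun φ =>
      (mem_strandCycles_iff G hi hW φ.2.1).1 φ.2
  refine (LinearEquiv.ofBijective T ⟨fun φ ψ h => ?_, fun f => ?_⟩).finrank_eq
  · exact Subtype.ext (eq_of_eraseTransform_eq G hW φ.2.1 ψ.2.1 (congrArg Subtype.val h))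
  · obtain ⟨φ, hφ, h⟩ := exists_eraseTransform_eq G hW f.2.1
    exact ⟨⟨φ, (mem_strandCycles_iff G hi hW hφ).2 (h ▸ f.2)⟩, Subtype.ext h⟩

/-- Boundaries come from the single set `W` and correspond to the constant functions; they account
for the `-1` of reduced cohomology. -/
lemma finrank_strandBoundaries_of_card_eq_add_one {W : Finset V} {i : ℕ} (hW : W.card = i + 1) :
    Module.finrank k (strandBoundaries k (graphStrand G W) i) = 1 := by
  classical
  have h : strandChains k (graphStrand G W) (i + 1) = Submodule.span k {Pi.single W 1} := by
    refine le_antisymm (fun φ hφ => ?_) ?_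
    · refine Submodule.mem_span_singleton.2 ⟨φ W, funext fun F => ?_⟩
      by_cases hF : F = W
      · subst hF
        simp
      · rw [Pi.smul_apply, Pi.single_eq_of_ne hF, smul_zero]
        by_cases hD : graphStrand G W F
        · refine (hφ.2 F fun hc => hF ?_).symm
          exact Finset.eq_of_subset_of_card_le (graphStrand_subset G hD) (by omega)
        · exact (hφ.1 F hD).symm
    · rw [Submodule.span_singleton_le_iff_mem]
      refine ⟨fun F hF => Pi.single_eq_of_ne ?_ _, fun F hF => Pi.single_eq_of_ne ?_ _⟩
      · rintro rfl
        exact hF (graphStrand_self G F)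
      · rintro rfl
        exact hF hW
  rw [strandBoundaries, h, Submodule.map_span, Set.image_singleton]
  refine finrank_span_singleton fun h0 => ?_
  obtain ⟨v, hv⟩ := Finset.card_pos.1 (by omega : 0 < W.card)
  have h1 := congrFun h0 (W.erase v)
  rw [strandD_of_mem (graphStrand_erase G W v), contraction_apply,
    Finset.sum_eq_single_of_mem v (by simp)] at h1
  · rw [Finset.insert_erase hv] at h1
    simp [koszulSign] at h1
  · intro u hu huv
    rw [Pi.single_eq_of_ne, smul_zero, smul_zero]
    intro he
    have : v ∈ insert u (W.erase v) := by rw [he]; exact hv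
    simp [huv.symm] at this

lemma finrank_faceHomology_of_card_eq_add_one {W : Finset V} {i : ℕ} (hi : 0 < i)
    (hW : W.card = i + 1) :
    Module.finrank k (faceHomology k (graphComplex G) W i) + 1 = componentCount k G W := by
  rw [← finrank_strandCycles G hi hW, ← finrank_strandBoundaries_of_card_eq_add_one (k := k) G hW]
  exact finrank_strandHomology_add (fun F hF => graphStrand_subset G hF)
    (fun F hF v hv => strand_graphComplex_insert G hF hv) i

/-- Sets of size `i` in the strand are the complements of edges, and no smaller set occurs, so every
chain is a cycle. -/
lemma finrank_strandCycles_of_card_eq_add_two {W : Finset V} {i : ℕ} (hi : 0 < i)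
    (hW : W.card = i + 2) :
    Module.finrank k (strandCycles k (graphStrand G W) i) = edgeCount G W := by
  classical
  let s : Finset (Finset V) := Finset.univ.filter fun F => graphStrand G W F ∧ F.card = i
  have h : strandCycles k (graphStrand G W) i = supportedOn k s := by
    ext φ
    constructor
    · rintro ⟨⟨h1, h2⟩, -⟩ F hF
      by_cases hD : graphStrand G W F
      · exact h2 F fun hc => hF (by simp [s, hD, hc])
      · exact h1 F hD
    · intro hφ
      have hc : φ ∈ strandChains k (graphStrand G W) i :=
        ⟨fun F hF => hφ F (by simp [s, hF]), fun F hF => hφ F (by simp [s, hF])⟩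
      refine ⟨hc, funext fun F => ?_⟩
      by_cases hF : graphStrand G W F
      · rw [strandD_of_mem hF]
        obtain ⟨j, rfl⟩ := Nat.exists_eq_add_of_lt hi
        have := card_le_of_graphStrand G hF
        refine Concentrated.contraction (i := j) 1 ?_ F (by omega)
        have := hc.2
        rwa [Nat.zero_add] at this
      · exact strandD_of_notMem hF φ
  rw [h, finrank_supportedOn, edgeCount]
  refine Finset.card_bij' (fun F _ => W \ F) (fun E _ => W \ E) ?_ ?_ ?_ ?_
  · intro F hF
    simp only [s, Finset.mem_filter, Finset.mem_univ, true_and] at hF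
    have hD := (strand_graphComplex_iff G W F).1 hF.1
    have := Finset.card_sdiff_add_card_eq_card hD.1
    exact (mem_edgesWithin G).2 ⟨Finset.sdiff_subset, by omega, hD.2.2⟩
  · intro E hE
    rw [mem_edgesWithin] at hE
    have := Finset.card_sdiff_add_card_eq_card hE.1
    simp only [s, Finset.mem_filter, Finset.mem_univ, true_and]
    refine ⟨(strand_graphComplex_iff G W _).2 ?_, by omega⟩
    rw [Finset.sdiff_sdiff_eq_self hE.1]
    exact ⟨Finset.sdiff_subset, hE.2.1.le, hE.2.2⟩
  · intro F hF
    simp only [s, Finset.mem_filter, Finset.mem_univ, true_and] at hF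
    exact Finset.sdiff_sdiff_eq_self (graphStrand_subset G hF.1)
  · intro E hE
    rw [mem_edgesWithin] at hE
    exact Finset.sdiff_sdiff_eq_self hE.1

/-- Rank-nullity for the coboundary from vertices to edges: its kernel has dimension
`componentCount`, so its image has dimension `|W|` minus that. -/
lemma finrank_faceHomology_of_card_eq_add_two {W : Finset V} {i : ℕ} (hi : 0 < i)
    (hW : W.card = i + 2) :
    Module.finrank k (faceHomology k (graphComplex G) W i) + W.card =
      edgeCount G W + componentCount k G W := by
  have h1 := finrank_strandHomology_add (k := k) (D := graphStrand G W)
    (fun F hF => graphStrand_subset G hF)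
    (fun F hF v hv => strand_graphComplex_insert G hF hv) i
  have h2 := finrank_map_add_finrank_inf_ker (strandChains k (graphStrand G W) (i + 1))
    (strandD k (graphStrand G W))
  have h3 := finrank_strandCycles (k := k) G (Nat.succ_pos i) hW
  have h4 := finrank_strandChains (k := k) G (i := i + 1) hW
  rw [finrank_strandCycles_of_card_eq_add_two G hi hW] at h1
  change Module.finrank k (strandBoundaries k (graphStrand G W) i) +
    Module.finrank k (strandCycles k (graphStrand G W) (i + 1)) = _ at h2
  change Module.finrank k (strandHomology k (graphStrand G W) i) + W.card = _
  rw [h3, h4] at h2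
  omega

end GraphStrands

/-! ### Chordal graphs and Dirac's theorem -/

section Chordal

variable {V : Type v} (G : SimpleGraph V)

lemma nonempty_cycleGraph_embedding {m : ℕ} (f : ℕ → V)
    (hf : ∀ i j, i < j → j < m → f i ≠ f j ∧
      (G.Adj (f i) (f j) ↔ j = i + 1 ∨ (i = 0 ∧ j + 1 = m))) :
    Nonempty (SimpleGraph.cycleGraph m ↪g G) := by
  have hadj (a b : Fin m) (h : a < b) :
      G.Adj (f a) (f b) ↔ (SimpleGraph.cycleGraph m).Adj a b := by
    have h1 : (b - a).val = b.val - a.val := Fin.sub_val_of_le h.le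
    have h2 : (a - b).val = m - (b.val - a.val) := by
      rw [Fin.val_sub, Nat.mod_eq_of_lt] <;> omega
    rw [(hf a b h b.2).2, SimpleGraph.cycleGraph_adj', h1, h2]
    omega
  have hinj : Function.Injective fun a : Fin m => f a := by
    intro a b hab
    rcases lt_trichotomy a b with h | h | h
    · exact absurd hab (hf a b h b.2).1
    · exact h
    · exact absurd hab.symm (hf b a h a.2).1
  refine ⟨⟨⟨fun a => f a, hinj⟩, ?_⟩⟩
  intro a b
  change G.Adj (f a) (f b) ↔ _
  rcases lt_trichotomy a b with h | h | h
  · exact hadj a b h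
  · subst h
    simp
  · rw [SimpleGraph.adj_comm, hadj b a h, SimpleGraph.adj_comm]

/-- The graph on all vertices whose edges are the edges of `G` inside `T`. -/
def edgesIn (T : Set V) : SimpleGraph V where
  Adj a b := G.Adj a b ∧ a ∈ T ∧ b ∈ T
  symm := ⟨fun _ _ h => ⟨h.1.symm, h.2.2, h.2.1⟩⟩
  loopless := ⟨fun _ h => h.1.ne rfl⟩

variable {G} in
-- A shortest walk has no chords, as a chord would shorten it.
lemma le_add_one_of_adj_getVert {s t : V} (p : G.Walk s t) (hp : p.length = G.dist s t) {i j : ℕ}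
    (hij : i < j) (hj : j ≤ p.length) (h : G.Adj (p.getVert i) (p.getVert j)) : j = i + 1 := by
  have hq := SimpleGraph.dist_le ((p.take i).append (SimpleGraph.Walk.cons h (p.drop j)))
  rw [SimpleGraph.Walk.length_append, SimpleGraph.Walk.length_cons, SimpleGraph.Walk.take_length,
    SimpleGraph.Walk.drop_length, ← hp] at hq
  omega

variable {G}

/-- Otherwise a shortest path from `s` to `t` through `C` closes up at `x` to an induced cycle,
because `x` is adjacent to no vertex of `C`. -/
lemma adj_of_reachable_edgesIn (hG : IsChordal G) {x s t : V} {C : Set V}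
    (hC : ∀ c ∈ C, c ≠ x ∧ ¬ G.Adj x c) (hs : G.Adj x s) (ht : G.Adj x t) (hst : s ≠ t)
    (h : (edgesIn G (C ∪ {s, t})).Reachable s t) : G.Adj s t := by
  by_contra hn
  obtain ⟨p, hp⟩ := h.exists_walk_length_eq_dist
  have hpath := p.isPath_of_length_eq_dist hp
  have h0 : p.length ≠ 0 := fun h => hst (SimpleGraph.Walk.eq_of_length_eq_zero h)
  have h1 : p.length ≠ 1 := fun h => hn (SimpleGraph.Walk.adj_of_length_eq_one h).1
  have hmem (j : ℕ) (hj : j ≤ p.length) : p.getVert j ∈ C ∪ {s, t} := by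
    rcases j with _ | j
    · rw [p.getVert_zero]
      exact Or.inr (Or.inl rfl)
    · exact (p.adj_getVert_succ hj).2.2
  have hxT : x ∉ C ∪ {s, t} := by
    rintro (h | h | h)
    · exact (hC x h).1 rfl
    · exact hs.ne h
    · exact ht.ne h
  -- The cycle consists of `x` and the `p.length + 1` vertices of the path; non-adjacency of `s` and
  -- `t` gives `p.length ≥ 2`.
  refine (hG (p.length + 2) (by omega)).false (nonempty_cycleGraph_embedding G
    (fun i => Nat.casesOn i x fun j => p.getVert j) ?_).some
  intro i j hij hj
  obtain ⟨j, rfl⟩ : ∃ j', j = j' + 1 := ⟨j - 1, by omega⟩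
  rcases i with _ | i
  · refine ⟨fun (h : x = p.getVert j) => hxT (h ▸ hmem j (by omega)), ?_⟩
    change G.Adj x (p.getVert j) ↔ _
    constructor
    · intro hadj
      rcases hmem j (by omega) with h | h | h
      · exact absurd hadj (hC _ h).2
      · have : j = 0 := hpath.getVert_injOn (by simp; omega) (by simp) (h.trans p.getVert_zero.symm)
        omega
      · have : j = p.length :=
          hpath.getVert_injOn (by simp; omega) (by simp)
            (Eq.trans h p.getVert_length.symm)
        omega
    · rintro (h | h)
      · obtain rfl : j = 0 := by omega
        rwa [p.getVert_zero]
      · obtain rfl : j = p.length := by omega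
        rwa [p.getVert_length]
  · change p.getVert i ≠ p.getVert j ∧ (G.Adj (p.getVert i) (p.getVert j) ↔ _)
    refine ⟨fun h => ?_, fun h => Or.inl ?_, fun h => ?_⟩
    · have : i = j := hpath.getVert_injOn (by simp; omega) (by simp; omega) h
      omega
    · have := le_add_one_of_adj_getVert p hp (by omega) (by omega)
        (show (edgesIn G (C ∪ {s, t})).Adj (p.getVert i) (p.getVert j) from
          ⟨h, hmem i (by omega), hmem j (by omega)⟩)
      omega
    · obtain rfl : j = i + 1 := by omega
      exact (p.adj_getVert_succ (by omega)).1

variable (G) in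
/-- A vertex is simplicial in `W` if its neighbours in `W` are pairwise adjacent. -/
def IsSimplicialIn (W : Finset V) (z : V) : Prop :=
  ∀ a ∈ W, ∀ b ∈ W, G.Adj z a → G.Adj z b → a ≠ b → G.Adj a b

lemma reachable_edgesIn_mono {A B : Set V} (h : A ⊆ B) {a b : V}
    (hab : (edgesIn G A).Reachable a b) : (edgesIn G B).Reachable a b :=
  hab.mono fun a b (hadj : (edgesIn G A).Adj a b) => ⟨hadj.1, h hadj.2.1, h hadj.2.2⟩

lemma reachable_edgesIn_component {U : Set V} {y a : V} (h : (edgesIn G U).Reachable y a) :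
    (edgesIn G {v | (edgesIn G U).Reachable y v}).Reachable y a := by
  rw [SimpleGraph.reachable_iff_reflTransGen] at h
  induction h with
  | refl => exact SimpleGraph.Reachable.refl _
  | tail hb hbc ih =>
    have hb' := (SimpleGraph.reachable_iff_reflTransGen ..).2 hb
    exact ih.trans (SimpleGraph.Adj.reachable ⟨hbc.1, hb', hb'.trans hbc.reachable⟩)

/-- Dirac's theorem, strengthened so that induction works: the simplicial vertex can be found away
from `x`. With `C` the component of `y` among the non-neighbours of `x`, and `S` the neighbours of
`x` attached to `C`, the set `S` is a clique and `C ∪ S` is smaller than `W`. -/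
lemma exists_isSimplicialIn_not_adj (hG : IsChordal G) (n : ℕ) : ∀ W : Finset V, W.card = n →
    ∀ x ∈ W, ∀ y ∈ W, y ≠ x → ¬ G.Adj x y →
      ∃ z ∈ W, z ≠ x ∧ ¬ G.Adj x z ∧ IsSimplicialIn G W z := by
  classical
  induction n using Nat.strong_induction_on with
  | _ n ih =>
    intro W hW x hx y hy hyx hxy
    set U : Set V := {v | v ∈ W ∧ v ≠ x ∧ ¬ G.Adj x v} with hU
    set C : Finset V := W.filter fun v => (edgesIn G U).Reachable y v with hC
    set S : Finset V := W.filter fun s => G.Adj x s ∧ ∃ c ∈ C, G.Adj s c with hS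
    have hCU : ∀ c ∈ C, c ∈ U := by
      intro c hc
      have h := (Finset.mem_filter.1 hc).2
      rw [SimpleGraph.reachable_iff_reflTransGen] at h
      rcases h.cases_tail with h | ⟨b, -, h⟩
      · exact h ▸ ⟨hy, hyx, hxy⟩
      · exact h.2.2
    have hyC : y ∈ C := Finset.mem_filter.2 ⟨hy, SimpleGraph.Reachable.refl _⟩
    have hCreach {A : Set V} (hA : (C : Set V) ⊆ A) : ∀ c ∈ C, (edgesIn G A).Reachable y c := by
      intro c hc
      refine reachable_edgesIn_mono ?_ (reachable_edgesIn_component (Finset.mem_filter.1 hc).2)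
      intro v hv
      refine hA (Finset.mem_filter.2 ⟨?_, hv⟩)
      rcases ((SimpleGraph.reachable_iff_reflTransGen ..).1 hv).cases_tail with h | ⟨b, -, h⟩
      · exact h ▸ hy
      · exact h.2.2.1
    have hSclique : ∀ s ∈ S, ∀ t ∈ S, s ≠ t → G.Adj s t := by
      intro s hs t ht hst
      obtain ⟨-, hxs, c, hc, hsc⟩ := Finset.mem_filter.1 hs
      obtain ⟨-, hxt, d, hd, htd⟩ := Finset.mem_filter.1 ht
      have hsub : (C : Set V) ⊆ (C : Set V) ∪ {s, t} := Set.subset_union_left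
      refine adj_of_reachable_edgesIn hG (C := (C : Set V)) (fun c hc => (hCU c hc).2)
        hxs hxt hst ?_
      refine SimpleGraph.Reachable.trans (SimpleGraph.Adj.reachable
        ⟨hsc, Or.inr (Or.inl rfl), hsub hc⟩) ?_
      refine (hCreach hsub c hc).symm.trans ((hCreach hsub d hd).trans
        (SimpleGraph.Adj.reachable ⟨htd.symm, hsub hd, Or.inr (Or.inr rfl)⟩))
    have hnbr : ∀ z ∈ C, ∀ a ∈ W, G.Adj z a → a ∈ C ∪ S := by
      intro z hz a ha hza
      have hzU := hCU z hz
      by_cases hxa : G.Adj x a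
      · exact Finset.mem_union_right _ (Finset.mem_filter.2 ⟨ha, hxa, z, hz, hza.symm⟩)
      · refine Finset.mem_union_left _ (Finset.mem_filter.2 ⟨ha, ?_⟩)
        refine (Finset.mem_filter.1 hz).2.trans (SimpleGraph.Adj.reachable ⟨hza, hzU, ha, ?_, hxa⟩)
        rintro rfl
        exact hzU.2.2 hza.symm
    have hxCS : x ∉ C ∪ S := by
      intro h
      rcases Finset.mem_union.1 h with h | h
      · exact (hCU x h).2.1 rfl
      · exact (Finset.mem_filter.1 h).2.1.ne rfl
    have hsubW : C ∪ S ⊆ W := Finset.union_subset (Finset.filter_subset _ _)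
      (Finset.filter_subset _ _)
    have hlt : (C ∪ S).card < n := hW ▸ Finset.card_lt_card
      (Finset.ssubset_iff_of_subset hsubW |>.2 ⟨x, hx, hxCS⟩)
    -- All neighbours in `W` of a vertex of `C` lie in `C ∪ S`.
    suffices ∃ z ∈ C, IsSimplicialIn G (C ∪ S) z by
      obtain ⟨z, hz, hsimp⟩ := this
      have hzU := hCU z hz
      exact ⟨z, hzU.1, hzU.2.1, hzU.2.2, fun a ha b hb hza hzb hab =>
        hsimp a (hnbr z hz a ha hza) b (hnbr z hz b hb hzb) hza hzb hab⟩
    -- Induction away from such an `s` yields a vertex not adjacent to `s`, hence outside the clique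
    -- `S`. If there is no such `s`, each vertex of `S` is adjacent to all others and only `C`
    -- matters.
    by_cases h1 : ∃ s ∈ S, ∃ w ∈ C ∪ S, w ≠ s ∧ ¬ G.Adj s w
    · obtain ⟨s, hs, w, hw, hws, hsw⟩ := h1
      obtain ⟨z, hz, hzs, hsz, hsimp⟩ := ih _ hlt (C ∪ S) rfl s (Finset.mem_union_right _ hs) w hw
        hws hsw
      rcases Finset.mem_union.1 hz with h | h
      · exact ⟨z, h, hsimp⟩
      · exact absurd (hSclique s hs z h hzs.symm) hsz
    · push Not at h1
      suffices ∃ z ∈ C, IsSimplicialIn G C z by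
        obtain ⟨z, hz, hsimp⟩ := this
        refine ⟨z, hz, fun a ha b hb hza hzb hab => ?_⟩
        by_cases haS : a ∈ S
        · exact h1 a haS b hb hab.symm
        by_cases hbS : b ∈ S
        · exact (h1 b hbS a ha hab).symm
        exact hsimp a ((Finset.mem_union.1 ha).resolve_right haS) b
          ((Finset.mem_union.1 hb).resolve_right hbS) hza hzb hab
      by_cases h2 : ∃ a ∈ C, ∃ b ∈ C, b ≠ a ∧ ¬ G.Adj a b
      · obtain ⟨a, ha, b, hb, hba, hab⟩ := h2
        obtain ⟨z, hz, -, -, hsimp⟩ := ih C.card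
          ((Finset.card_le_card Finset.subset_union_left).trans_lt hlt) C rfl a ha b hb hba hab
        exact ⟨z, hz, hsimp⟩
      · push Not at h2
        exact ⟨y, hyC, fun a ha b hb _ _ hab => h2 a ha b hb hab.symm⟩

/-- Dirac's theorem: chordal graphs have simplicial vertices. -/
lemma exists_isSimplicialIn (hG : IsChordal G) {W : Finset V} (hW : W.Nonempty) :
    ∃ z ∈ W, IsSimplicialIn G W z := by
  by_cases h : ∃ x ∈ W, ∃ y ∈ W, y ≠ x ∧ ¬ G.Adj x y
  · obtain ⟨x, hx, y, hy, hyx, hxy⟩ := h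
    obtain ⟨z, hz, -, -, hsimp⟩ := exists_isSimplicialIn_not_adj hG _ W rfl x hx y hy hyx hxy
    exact ⟨z, hz, hsimp⟩
  · push Not at h
    obtain ⟨z, hz⟩ := hW
    exact ⟨z, hz, fun a ha b hb _ _ hab => h a ha b hb hab.symm⟩

end Chordal

/-! ### The counting inequality for chordal graphs -/

section Counting

variable {k : Type u} [Field k] {V : Type v} [Fintype V] {G : SimpleGraph V}

lemma componentCount_pos {W : Finset V} (hW : W.Nonempty) : 0 < componentCount k G W := by
  classical
  obtain ⟨w, hw⟩ := hW
  have : Nontrivial (locallyConstant k G W) := by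
    refine ⟨⟨⟨fun v => if v ∈ W then 1 else 0, fun v hv => if_neg hv,
      fun u hu v hv _ => (if_pos hu).trans (if_pos hv).symm⟩, 0, fun h => ?_⟩⟩
    have := congrFun (congrArg Subtype.val h) w
    simp [hw] at this
  exact Module.finrank_pos

lemma componentCount_le_one {W : Finset V} (w : V)
    (h : ∀ f ∈ locallyConstant k G W, f w = 0 → f = 0) : componentCount k G W ≤ 1 := by
  rw [← Module.finrank_self k]
  refine LinearMap.finrank_le_finrank_of_injective
    (f := (LinearMap.proj w).comp (locallyConstant k G W).subtype) ?_
  rw [← LinearMap.ker_eq_bot, LinearMap.ker_eq_bot']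
  exact fun f hf => Subtype.ext (h f.1 f.2 hf)

lemma componentCount_of_forall_not_adj (h : ∀ u v, ¬ G.Adj u v) :
    componentCount k G Finset.univ = Fintype.card V := by
  have : locallyConstant k G Finset.univ = ⊤ := by
    refine eq_top_iff.2 fun f _ => ⟨fun v hv => absurd (Finset.mem_univ v) hv, ?_⟩
    exact fun u _ v _ huv => absurd huv (h u v)
  rw [componentCount, this, finrank_top, Module.finrank_fintype_fun_eq_card]

open Classical in
-- The neighbours of `z` in `W` are pairwise adjacent, so a locally constant function takes one
-- value on them and extends to `z` by that value.
lemma componentCount_erase_le {W : Finset V} {z a : V} (hz : IsSimplicialIn G W z)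
    (ha : a ∈ W) (hza : G.Adj z a) : componentCount k G (W.erase z) ≤ componentCount k G W := by
  have key (g : V → k) (hg : g ∈ locallyConstant k G (W.erase z)) (v : V) (hv : v ∈ W)
      (hzv : G.Adj z v) : g a = g v := by
    by_cases hav : a = v
    · rw [hav]
    · exact hg.2 a (Finset.mem_erase.2 ⟨hza.ne', ha⟩) v (Finset.mem_erase.2 ⟨hzv.ne', hv⟩)
        (hz a ha v hv hza hzv hav)
  let T : locallyConstant k G (W.erase z) →ₗ[k] locallyConstant k G W :=
    { toFun g := ⟨fun v => if v = z then (if z ∈ W then g.1 a else 0) else g.1 v, by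
        constructor
        · intro v hv
          beta_reduce
          by_cases hvz : v = z
          · rw [if_pos hvz, if_neg (hvz ▸ hv)]
          · rw [if_neg hvz]
            exact g.2.1 v fun h => hv (Finset.mem_of_mem_erase h)
        · intro u hu v hv huv
          beta_reduce
          by_cases huz : u = z
          · subst huz
            rw [if_pos rfl, if_neg huv.ne', if_pos hu, key g.1 g.2 v hv huv]
          · by_cases hvz : v = z
            · subst hvz
              rw [if_neg huz, if_pos rfl, if_pos hv, key g.1 g.2 u hu huv.symm]
            · rw [if_neg huz, if_neg hvz]
              exact g.2.2 u (Finset.mem_erase.2 ⟨huz, hu⟩) v (Finset.mem_erase.2 ⟨hvz, hv⟩) huv⟩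
      map_add' f g := by
        ext v
        by_cases hv : v = z <;> by_cases hz : z ∈ W <;> simp [hv, hz]
      map_smul' c g := by
        ext v
        by_cases hv : v = z <;> by_cases hz : z ∈ W <;> simp [hv, hz] }
  refine LinearMap.finrank_le_finrank_of_injective (f := T) ?_
  intro f g hfg
  refine Subtype.ext (funext fun v => ?_)
  by_cases hv : v = z
  · rw [f.2.1 v (by simp [hv]), g.2.1 v (by simp [hv])]
  · simpa [T, hv] using congrFun (congrArg Subtype.val hfg) v

open Classical in
-- The value at an isolated vertex is free.
lemma componentCount_erase_lt {W : Finset V} {z : V} (hzW : z ∈ W)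
    (hz : ∀ a ∈ W, ¬ G.Adj z a) :
    componentCount k G (W.erase z) + 1 ≤ componentCount k G W := by
  let T : locallyConstant k G (W.erase z) × k →ₗ[k] locallyConstant k G W :=
    { toFun p := ⟨fun v => if v = z then p.2 else p.1.1 v, by
        constructor
        · intro v hv
          beta_reduce
          rw [if_neg (ne_of_mem_of_not_mem hzW hv).symm]
          exact p.1.2.1 v fun h => hv (Finset.mem_of_mem_erase h)
        · intro u hu v hv huv
          have huz : u ≠ z := by
            rintro rfl
            exact hz v hv huv
          have hvz : v ≠ z := by
            rintro rfl
            exact hz u hu huv.symm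
          beta_reduce
          rw [if_neg huz, if_neg hvz]
          exact p.1.2.2 u (Finset.mem_erase.2 ⟨huz, hu⟩) v (Finset.mem_erase.2 ⟨hvz, hv⟩) huv⟩
      map_add' f g := by
        ext v
        by_cases hv : v = z <;> simp [hv]
      map_smul' c g := by
        ext v
        by_cases hv : v = z <;> simp [hv] }
  have hT : Function.Injective T := by
    intro f g hfg
    have h (v) := congrFun (congrArg Subtype.val hfg) v
    refine Prod.ext (Subtype.ext (funext fun v => ?_)) (by simpa [T] using h z)
    by_cases hv : v = z
    · rw [f.1.2.1 v (by simp [hv]), g.1.2.1 v (by simp [hv])]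
    · simpa [T, hv] using h v
  have := LinearMap.finrank_le_finrank_of_injective hT
  rwa [Module.finrank_prod, Module.finrank_self] at this

open Classical in
lemma edgeCount_erase_add_card_le {W T : Finset V} {z : V} (hz : z ∈ W) (hT : T ⊆ W)
    (hadj : ∀ a ∈ T, G.Adj z a) : edgeCount G (W.erase z) + T.card ≤ edgeCount G W := by
  have hinj : Set.InjOn (fun a : V => ({z, a} : Finset V)) T := by
    intro a ha b hb hab
    have : a ∈ ({z, b} : Finset V) := (show ({z, a} : Finset V) = {z, b} from hab) ▸ (by simp)
    rcases Finset.mem_insert.1 this with h | h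
    · exact absurd h (hadj a ha).ne'
    · exact Finset.mem_singleton.1 h
  have hdisj : Disjoint (edgesWithin G (W.erase z)) (T.image fun a : V => ({z, a} : Finset V)) := by
    refine Finset.disjoint_left.2 fun E hE hE' => ?_
    obtain ⟨a, -, rfl⟩ := Finset.mem_image.1 hE'
    exact Finset.notMem_erase z W (((mem_edgesWithin G).1 hE).1 (Finset.mem_insert_self z _))
  rw [edgeCount, ← Finset.card_image_of_injOn hinj, ← Finset.card_union_of_disjoint hdisj]
  refine Finset.card_le_card (Finset.union_subset (fun E hE => ?_) fun E hE => ?_)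
  · obtain ⟨h1, h2⟩ := (mem_edgesWithin G).1 hE
    exact (mem_edgesWithin G).2 ⟨h1.trans (Finset.erase_subset z W), h2⟩
  · obtain ⟨a, ha, rfl⟩ := Finset.mem_image.1 hE
    refine (mem_edgesWithin G).2 ⟨?_, Finset.card_pair (hadj a ha).ne, ?_⟩
    · exact Finset.insert_subset hz (Finset.singleton_subset_iff.2 (hT ha))
    · rw [Finset.coe_pair, SimpleGraph.isClique_pair]
      exact fun _ => hadj a ha

open Classical in
-- Three units are gained by restoring `z`. The term of `z` in the sum is at least one. With two
-- neighbours, two edges are added. With exactly one neighbour `a`, one edge is added, and `z` is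
-- isolated in `W - a`, which raises that term. With none, `z` is a new component of `W` and of
-- every `W - u`.
lemma three_mul_card_le_step {W : Finset V} {z : V} (hzW : z ∈ W) (hz : IsSimplicialIn G W z)
    (hne : (W.erase z).Nonempty) (ih : 3 * (W.erase z).card ≤
      ∑ v ∈ W.erase z, componentCount k G ((W.erase z).erase v) + edgeCount G (W.erase z) +
        componentCount k G (W.erase z) + 2) :
    3 * W.card ≤ ∑ v ∈ W, componentCount k G (W.erase v) + edgeCount G W +
      componentCount k G W + 2 := by
  rw [← Finset.add_sum_erase W (fun v => componentCount k G (W.erase v)) hzW]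
  have hcard := Finset.card_erase_add_one hzW
  have hpos := componentCount_pos (k := k) (G := G) hne
  have hsub (u : V) : IsSimplicialIn G (W.erase u) z := fun a ha b hb =>
    hz a (Finset.mem_of_mem_erase ha) b (Finset.mem_of_mem_erase hb)
  have hmem (u : V) (hu : u ∈ W.erase z) : z ∈ W.erase u :=
    Finset.mem_erase.2 ⟨(Finset.ne_of_mem_erase hu).symm, hzW⟩
  have hle (u : V) (hu : u ∈ W.erase z) :
      componentCount k G ((W.erase z).erase u) ≤ componentCount k G (W.erase u) := by
    rw [Finset.erase_right_comm]
    by_cases h : ∃ a ∈ W.erase u, G.Adj z a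
    · obtain ⟨a, ha, hza⟩ := h
      exact componentCount_erase_le (hsub u) ha hza
    · push Not at h
      exact (Nat.le_succ _).trans (componentCount_erase_lt (hmem u hu) h)
  have hsum := Finset.sum_le_sum hle
  by_cases h0 : ∃ a ∈ W, G.Adj z a
  · obtain ⟨a, ha, hza⟩ := h0
    have h1 := componentCount_erase_le (k := k) hz ha hza
    by_cases h2 : ∃ b ∈ W, G.Adj z b ∧ b ≠ a
    · obtain ⟨b, hb, hzb, hba⟩ := h2
      have h3 := edgeCount_erase_add_card_le (G := G) (T := {a, b}) hzW
        (Finset.insert_subset ha (Finset.singleton_subset_iff.2 hb)) (by simp [hza, hzb])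
      rw [Finset.card_pair hba.symm] at h3
      omega
    · push Not at h2
      have h3 := edgeCount_erase_add_card_le (G := G) (T := {a}) hzW
        (Finset.singleton_subset_iff.2 ha) (by simp [hza])
      rw [Finset.card_singleton] at h3
      have haz : a ∈ W.erase z := Finset.mem_erase.2 ⟨hza.ne', ha⟩
      have h4 := Finset.sum_lt_sum hle ⟨a, haz, by
        rw [Finset.erase_right_comm]
        exact componentCount_erase_lt (hmem a haz) fun b hb hzb =>
          (Finset.ne_of_mem_erase hb) (h2 b (Finset.mem_of_mem_erase hb) hzb)⟩
      omega
  · push Not at h0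
    have h1 := componentCount_erase_lt (k := k) hzW h0
    have h3 := edgeCount_erase_add_card_le (G := G) (T := ∅) hzW (Finset.empty_subset W) (by simp)
    obtain ⟨u, hu⟩ := hne
    have h4 := Finset.sum_lt_sum hle ⟨u, hu, by
      rw [Finset.erase_right_comm]
      exact componentCount_erase_lt (hmem u hu) fun b hb => h0 b (Finset.mem_of_mem_erase hb)⟩
    omega

open Classical in
lemma three_mul_card_le (hG : IsChordal G) (W : Finset V) :
    3 * W.card ≤ ∑ v ∈ W, componentCount k G (W.erase v) + edgeCount G W +
      componentCount k G W + 2 := by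
  induction W using Finset.strongInduction with
  | H W ih =>
    rcases W.eq_empty_or_nonempty with rfl | hW
    · simp
    obtain ⟨z, hzW, hz⟩ := exists_isSimplicialIn hG hW
    rcases (W.erase z).eq_empty_or_nonempty with h | h
    · have h1 := componentCount_pos (k := k) (G := G) hW
      have h2 := Finset.card_erase_add_one hzW
      rw [h, Finset.card_empty] at h2
      omega
    · exact three_mul_card_le_step hzW hz h (ih _ (Finset.erase_ssubset hzW))

end Counting

/-! ### Counts on a cycle -/

section Cycle

variable {k : Type u} [Field k] {V : Type v} {G : SimpleGraph V} {n : ℕ}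

lemma cycleGraph_adj_iff_eq_add_one (a b : Fin (n + 4)) :
    (SimpleGraph.cycleGraph (n + 4)).Adj a b ↔ a = b + 1 ∨ b = a + 1 := by
  have h (x : Fin (n + 4)) : x.val = 1 ↔ x = 1 := by
    rw [Fin.ext_iff]
    rfl
  rw [SimpleGraph.cycleGraph_adj', h, h, sub_eq_iff_eq_add', sub_eq_iff_eq_add']

lemma eq_zero_of_cycle (e : SimpleGraph.cycleGraph (n + 4) ≃g G) (a : Fin (n + 4)) {f : V → k}
    (h0 : f (e (a + 1)) = 0)
    (hf : ∀ u v, u ≠ e a → v ≠ e a → G.Adj u v → f u = f v) (b : Fin (n + 4)) (hb : b ≠ a) :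
    f (e b) = 0 := by
  -- Induction on the distance from `a + 1` walks around the cycle and stops before `a`, so the
  -- deleted vertex is never used.
  obtain ⟨j, hj⟩ : ∃ j, (b - (a + 1)).val = j := ⟨_, rfl⟩
  induction j generalizing b with
  | zero =>
    have : b - (a + 1) = 0 := Fin.ext hj
    rw [sub_eq_zero.1 this]
    exact h0
  | succ j ih =>
    have hb' : b - 1 ≠ a := by
      rintro rfl
      simp at hj
    have hne : b - (a + 1) ≠ 0 := by
      intro h
      rw [h] at hj
      simp at hj
    have hval : (b - 1 - (a + 1)).val = j := by
      rw [sub_right_comm, Fin.val_sub_one_of_ne_zero hne, hj, Nat.add_sub_cancel]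
    refine (hf (e b) (e (b - 1)) (fun h => hb (e.injective h)) (fun h => hb' (e.injective h))
      (e.map_adj_iff.2 ?_)).trans (ih (b - 1) hb' hval)
    rw [cycleGraph_adj_iff_eq_add_one, sub_add_cancel]
    exact Or.inl rfl

variable [Fintype V]

lemma componentCount_univ_cycle_le (e : SimpleGraph.cycleGraph (n + 4) ≃g G) :
    componentCount k G Finset.univ ≤ 1 := by
  refine componentCount_le_one (e (0 + 1)) fun f hf h0 => funext fun v => ?_
  have hadj (u v : V) (h : G.Adj u v) : f u = f v :=
    hf.2 u (Finset.mem_univ u) v (Finset.mem_univ v) h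
  obtain ⟨b, rfl⟩ := e.surjective v
  by_cases hb : b = 0
  · rw [hb]
    refine (hadj _ _ (e.map_adj_iff.2 ?_)).trans h0
    exact (cycleGraph_adj_iff_eq_add_one _ _).2 (Or.inr rfl)
  · exact eq_zero_of_cycle e 0 h0 (fun u v _ _ h => hadj u v h) b hb

open Classical in
lemma componentCount_univ_erase_cycle_le (e : SimpleGraph.cycleGraph (n + 4) ≃g G) (v : V) :
    componentCount k G (Finset.univ.erase v) ≤ 1 := by
  obtain ⟨a, rfl⟩ := e.surjective v
  refine componentCount_le_one (e (a + 1)) fun f hf h0 => funext fun v => ?_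
  obtain ⟨b, rfl⟩ := e.surjective v
  by_cases hb : b = a
  · exact hf.1 _ (by simp [hb])
  · exact eq_zero_of_cycle e a h0 (fun u v hu hv h => hf.2 u (by simp [hu]) v (by simp [hv]) h) b hb

open Classical in
lemma edgeCount_univ_cycle_le (e : SimpleGraph.cycleGraph (n + 4) ≃g G) :
    edgeCount G Finset.univ ≤ n + 4 := by
  have hsub : edgesWithin G Finset.univ ⊆
      Finset.univ.image fun a : Fin (n + 4) => ({e a, e (a + 1)} : Finset V) := by
    intro E hE
    obtain ⟨-, h2, hcl⟩ := (mem_edgesWithin G).1 hE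
    obtain ⟨x, y, hxy, rfl⟩ := Finset.card_eq_two.1 h2
    obtain ⟨a, rfl⟩ := e.surjective x
    obtain ⟨b, rfl⟩ := e.surjective y
    have hadj : G.Adj (e a) (e b) := hcl (by simp) (by simp) hxy
    rw [e.map_adj_iff, cycleGraph_adj_iff_eq_add_one] at hadj
    rcases hadj with rfl | rfl
    · exact Finset.mem_image.2 ⟨b, Finset.mem_univ b, Finset.pair_comm _ _⟩
    · exact Finset.mem_image.2 ⟨a, Finset.mem_univ a, rfl⟩
  refine (Finset.card_le_card hsub).trans (Finset.card_image_le.trans ?_)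
  rw [Finset.card_univ, Fintype.card_fin]

end Cycle

/-! ### The type defect of a graph -/

section Defect

variable {k : Type u} [Field k] {V : Type v} [Fintype V] {G : SimpleGraph V}

open Classical in
lemma sum_finset_eq_of_card_lt (f : Finset V → ℕ)
    (hf : ∀ W : Finset V, W.card + 1 < Fintype.card V → f W = 0) :
    ∑ W, f W = ∑ v, f (Finset.univ.erase v) + f Finset.univ := by
  have hinj : Set.InjOn (fun v : V => (Finset.univ : Finset V).erase v)
      (Finset.univ : Finset V) := by
    intro a _ b _ hab
    by_contra h
    exact Finset.notMem_erase b Finset.univ ((show (Finset.univ : Finset V).erase a =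
      Finset.univ.erase b from hab) ▸ Finset.mem_erase.2 ⟨Ne.symm h, Finset.mem_univ b⟩)
  have hnot : (Finset.univ : Finset V) ∉
      Finset.univ.image fun v : V => (Finset.univ : Finset V).erase v := by
    intro h
    obtain ⟨v, -, hv⟩ := Finset.mem_image.1 h
    exact Finset.notMem_erase v Finset.univ (hv.symm ▸ Finset.mem_univ v)
  rw [← Finset.sum_image (f := f) hinj, add_comm, ← Finset.sum_insert hnot]
  refine (Finset.sum_subset (Finset.subset_univ _) fun W _ hW => hf W ?_).symm
  rw [Finset.mem_insert, not_or] at hW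
  have h1 : 1 < Wᶜ.card := by
    by_contra h
    rcases Nat.le_one_iff_eq_zero_or_eq_one.1 (not_lt.1 h) with h | h
    · exact hW.1 (by rwa [Finset.card_eq_zero, Finset.compl_eq_empty_iff] at h)
    · obtain ⟨v, hv⟩ := Finset.card_eq_one.1 h
      refine hW.2 (Finset.mem_image.2 ⟨v, Finset.mem_univ v, ?_⟩)
      rw [← compl_compl W, hv, Finset.compl_singleton]
  have := Finset.card_add_card_compl W
  omega

/-- A linear order on a finite type, obtained from an enumeration. -/
abbrev enumerationOrder (V : Type v) [Fintype V] : LinearOrder V :=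
  LinearOrder.lift' (Fintype.equivFin V) (Fintype.equivFin V).injective

variable (k G) in
-- The Koszul signs require a linear order on the vertices. The conclusion is free of it, so the
-- order is chosen and discarded here.
lemma exists_betti_graphComplex_eq_sum {i : ℕ} (hi : 0 < i) :
    ∃ φ : Finset V → ℕ, betti k (graphComplex G) i = ∑ W, φ W ∧ (∀ W, W.card ≤ i → φ W = 0) ∧
      (∀ W, W.card = i + 1 → φ W + 1 = componentCount k G W) ∧
      ∀ W, W.card = i + 2 → φ W + W.card = edgeCount G W + componentCount k G W := by
  have : LinearOrder V := enumerationOrder V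
  exact ⟨fun W => Module.finrank k (faceHomology k (graphComplex G) W i), betti_eq_sum _ i,
    fun W hW => finrank_faceHomology_eq_zero G hi (Or.inl hW),
    fun W hW => finrank_faceHomology_of_card_eq_add_one G hi hW,
    fun W hW => finrank_faceHomology_of_card_eq_add_two G hi hW⟩

open Classical in
-- The term `2 * |V|` collects the `-1` of each vertex-deleted set and the `-|V|` of the cycle rank
-- of the whole graph.
lemma betti_graphComplex_of_card_eq_add_two {i : ℕ} (hi : 0 < i) (hV : Fintype.card V = i + 2) :
    betti k (graphComplex G) i + 2 * Fintype.card V =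
      ∑ v, componentCount k G (Finset.univ.erase v) + edgeCount G Finset.univ +
        componentCount k G Finset.univ := by
  obtain ⟨φ, hφ, hφ0, hφ1, hφ2⟩ := exists_betti_graphComplex_eq_sum k G hi
  rw [hφ, sum_finset_eq_of_card_lt φ fun W hW => hφ0 W (by omega)]
  have h2 := hφ2 Finset.univ hV
  have h3 : ∀ v ∈ Finset.univ, φ (Finset.univ.erase v) + 1 =
      componentCount k G (Finset.univ.erase v) := fun v hv =>
    hφ1 _ (by rw [Finset.card_erase_of_mem hv, Finset.card_univ, hV]; rfl)
  have h4 := Finset.sum_congr rfl h3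
  rw [Finset.sum_add_distrib, Finset.sum_const, smul_eq_mul, mul_one] at h4
  rw [Finset.card_univ] at h2 h4
  omega

lemma betti_graphComplex_of_card_eq_add_one {i : ℕ} (hi : 0 < i) (hV : Fintype.card V = i + 1) :
    betti k (graphComplex G) i + 1 = componentCount k G Finset.univ := by
  obtain ⟨φ, hφ, hφ0, hφ1, -⟩ := exists_betti_graphComplex_eq_sum k G hi
  rw [hφ, Finset.sum_eq_single Finset.univ, hφ1 _ hV]
  · intro W _ hW
    refine hφ0 W (Nat.le_of_lt_succ (lt_of_lt_of_eq ?_ hV))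
    exact Finset.card_lt_card (Finset.ssubset_univ_iff.2 hW)
  · exact fun h => absurd (Finset.mem_univ _) h

lemma mem_graphComplex {F : Finset V} :
    F ∈ graphComplex G ↔ F.Nonempty ∧ F.card ≤ 2 ∧ G.IsClique (F : Set V) := Iff.rfl

open Classical in
lemma codim_graphComplex_of_adj {a b : V} (hab : G.Adj a b) :
    codim (graphComplex G) = Fintype.card V - 2 := by
  refine congrArg (Fintype.card V - ·) (le_antisymm (Finset.sup_le fun F hF => ?_) ?_)
  · exact (mem_graphComplex.1 (Finset.mem_filter.1 hF).2).2.1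
  · refine (Finset.card_pair hab.ne).symm.le.trans (Finset.le_sup (f := Finset.card)
      (Finset.mem_filter.2 ⟨Finset.mem_univ _, mem_graphComplex.2 ⟨Finset.insert_nonempty _ _,
        Finset.card_le_two, ?_⟩⟩))
    rw [Finset.coe_pair, SimpleGraph.isClique_pair]
    exact fun _ => hab

open Classical in
lemma codim_graphComplex_of_forall_not_adj [Nonempty V] (h : ∀ u v, ¬ G.Adj u v) :
    codim (graphComplex G) = Fintype.card V - 1 := by
  refine congrArg (Fintype.card V - ·) (le_antisymm (Finset.sup_le fun F hF => ?_) ?_)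
  · by_contra hlt
    obtain ⟨a, ha, b, hb, hab⟩ := Finset.one_lt_card.1 (not_le.1 hlt)
    exact h a b ((mem_graphComplex.1 (Finset.mem_filter.1 hF).2).2.2 ha hb hab)
  · obtain ⟨v⟩ := ‹Nonempty V›
    exact (Finset.card_singleton v).symm.le.trans (Finset.le_sup (f := Finset.card)
      (Finset.mem_filter.2 ⟨Finset.mem_univ _, (graphComplex G).singleton_mem v⟩))

variable (k) in
lemma typeDefect_nonneg_of_isChordal (hG : IsChordal G) : 0 ≤ typeDefect k (graphComplex G) := by
  classical
  have : LinearOrder V := enumerationOrder V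
  rw [typeDefect, modifiedType]
  rcases Nat.eq_zero_or_pos (codim (graphComplex G)) with h0 | hpos
  · have := gradedBetti_le_betti (k := k) (graphComplex G) 0 0
    rw [h0]
    omega
  rw [gradedBetti_self_eq_zero _ hpos]
  suffices codim (graphComplex G) ≤ betti k (graphComplex G) (codim (graphComplex G)) by omega
  by_cases h : ∃ a b, G.Adj a b
  · obtain ⟨a, b, hab⟩ := h
    rw [codim_graphComplex_of_adj hab] at hpos ⊢
    have h1 := betti_graphComplex_of_card_eq_add_two (k := k) (G := G) hpos (by omega)
    have h2 := three_mul_card_le (k := k) hG Finset.univ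
    rw [Finset.card_univ] at h2
    omega
  · push Not at h
    have : Nonempty V := by
      by_contra hV
      rw [not_nonempty_iff] at hV
      rw [codim, Fintype.card_eq_zero, Nat.zero_sub] at hpos
      exact hpos.false
    rw [codim_graphComplex_of_forall_not_adj h] at hpos ⊢
    have h1 := betti_graphComplex_of_card_eq_add_one (k := k) (G := G) hpos (by omega)
    rw [componentCount_of_forall_not_adj h] at h1
    omega

variable (k) in
lemma typeDefect_neg_of_cycle {n : ℕ} (e : SimpleGraph.cycleGraph (n + 4) ≃g G) :
    typeDefect k (graphComplex G) < 0 := by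
  classical
  have hadj : G.Adj (e 0) (e (0 + 1)) :=
    e.map_adj_iff.2 ((cycleGraph_adj_iff_eq_add_one _ _).2 (Or.inr rfl))
  have hcard : Fintype.card V = n + 4 := by
    rw [← Fintype.card_congr e.toEquiv, Fintype.card_fin]
  have hcodim : codim (graphComplex G) = n + 2 := by
    rw [codim_graphComplex_of_adj hadj, hcard]
    rfl
  rw [typeDefect, modifiedType, hcodim]
  -- With `N = n + 4` vertices the right side is at most `N + N + 1`, so the Betti number is at most
  -- `1 < n + 2`; subtracting the graded part can only lower it.
  have h1 := betti_graphComplex_of_card_eq_add_two (k := k) (G := G) (i := n + 2) (by omega) hcard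
  have h2 := componentCount_univ_cycle_le (k := k) e
  have h3 := edgeCount_univ_cycle_le e
  have h4 := Finset.sum_le_card_nsmul Finset.univ _ 1 fun v _ =>
    componentCount_univ_erase_cycle_le (k := k) e v
  rw [Finset.card_univ, smul_eq_mul, mul_one] at h4
  omega

end Defect

end TypeDefect

end

/-! ### The characterization of chordality -/

theorem mainTheorem5 {k : Type*} [Field k] {V : Type*} [Fintype V] (G : SimpleGraph V) :
    TypeDefect.IsChordal G ↔
      ∀ W : Finset V, 0 ≤ TypeDefect.typeDefect k
        (TypeDefect.graphComplex (G.induce (W : Set V))) := by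
  refine ⟨fun hG W => TypeDefect.typeDefect_nonneg_of_isChordal k fun m hm =>
    ⟨fun φ => (hG m hm).false ((SimpleGraph.Embedding.induce (W : Set V)).comp φ)⟩,
    fun h m hm => ⟨fun φ => ?_⟩⟩
  obtain ⟨n, rfl⟩ : ∃ n, m = n + 4 := ⟨m - 4, by omega⟩
  have hmem (a : Fin (n + 4)) : φ a ∈ (Finset.univ.map φ.toEmbedding : Set V) := by simp
  -- The set `W` violating the inequality is the vertex set of the induced cycle.
  let e : SimpleGraph.cycleGraph (n + 4) ≃g G.induce (Finset.univ.map φ.toEmbedding : Set V) :=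
    { Equiv.ofBijective (fun a => ⟨φ a, hmem a⟩) ⟨fun a b hab =>
        φ.injective (congrArg Subtype.val hab), fun ⟨v, hv⟩ => by
          obtain ⟨a, -, rfl⟩ := Finset.mem_map.1 (Finset.mem_coe.1 hv)
          exact ⟨a, rfl⟩⟩ with
      map_rel_iff' := φ.map_rel_iff }
  exact absurd (h _) (not_le.2 (TypeDefect.typeDefect_neg_of_cycle k e))
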